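/- \textbf{Dispersion process.} Let $n\in\mathbb N$ and let $M\in\mathbb N$ be a number of particles $p_1,\dots,p_M$ on the $n$ vertices $\{1,\dots,n\}$. At step $0$ all particles are on one distinguished vertex and all are unhappy. Let $(G_{i,t})_{1\le i\le M,\,t\in\mathbb N_0}$ be independent and uniformly distributed on $\{1,\dots,n\}$. In step $t+1$ each particle $p_i$ that is unhappy at step $t$ moves to vertex $G_{i,t+1}$ and each particle that is happy at step $t$ stays where it is; then the particles that are alone on their vertex are happy at step $t+1$ and all others are unhappy at step $t+1$. Let $U_t$ be the number of unhappy particles at step $t$ (so $U_0=M$), and for $\delta>0$ let \[ T_{n,M,\delta}:=\inf\{t>0 : U_t\le n^{1/2}/\delta\}. \] \textbf{Lemma.} There are a $\chi\in\mathbb R$ and a sequence $r_n\to0$ such that the following is true. Let $\varepsilon>0$, $\alpha\in\mathbb R$ and $M=M(n)\in\mathbb N$ with $M(n)=n/2+\alpha n^{1/2}+o(n^{1/2})$ as $n\to\infty$. Then for all sufficiently small $\delta>0$ (depending on $\varepsilon,\alpha,M(\cdot)$) and all sufficiently large $n$ (depending also on $\delta$), with probability at least $1-\delta$ the time $T_{n,M,\delta}$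 is finite and all of the following hold: \[ \Big|U_{T_{n,M,\delta}}-\frac{n^{1/2}}{\delta}\Big|\le r_n\,\frac{n^{1/2}}{\delta},\qquad \Big|T_{n,M,\delta}-\frac47\delta n^{1/2}\Big|\le \varepsilon\,\frac47\delta n^{1/2}, \] \[ \Big|\sum_{0\le t\le T_{n,M,\delta}}U_t-\Big(\frac27 n\ln n+\frac47 n\ln\delta+\chi n\Big)\Big|\le\varepsilon n. \] (The first of these is the assertion $U_{T_{n,M,\delta}}\sim n^{1/2}/\delta$, with an error term that is uniform in all other parameters.) -/

import Mathlib

open Filter Topology MeasureTheory ProbabilityTheory Asymptotics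

namespace Dispersion

/-- Given the positions `p` of `M` particles on the `n` vertices, the set of particles that share
their vertex with at least one other particle. -/
def collided {n M : ℕ} (p : Fin M → Fin n) : Finset (Fin M) :=
  {i | ∃ j, j ≠ i ∧ p i = p j}

/-- The state of the dispersion process at step `t`: the positions of the particles together with the
set of unhappy particles. Initially all particles sit on the vertex `v₀` and are unhappy. In step
`t + 1` each unhappy particle `i` moves to `g i (t + 1)`, each happy particle stays where it is, and
afterwards exactly the particles that share their vertex with another particle are unhappy. -/
def state {n M : ℕ} (v₀ : Fin n) (g : Fin M → ℕ → Fin n) :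
    ℕ → (Fin M → Fin n) × Finset (Fin M)
  | 0 => (fun _ => v₀, Finset.univ)
  | t + 1 =>
    let p : Fin M → Fin n := fun i =>
      if i ∈ (state v₀ g t).2 then g i (t + 1) else (state v₀ g t).1 i
    (p, collided p)

/-- The number of unhappy particles at step `t`. -/
def numUnhappy {n M : ℕ} (v₀ : Fin n) (g : Fin M → ℕ → Fin n) (t : ℕ) : ℕ :=
  (state v₀ g t).2.card

/-- The first step `t > 0` with at most `√n / δ` unhappy particles (`⊤` if there is none). -/
noncomputable def hitTime {n M : ℕ} (v₀ : Fin n) (g : Fin M → ℕ → Fin n) (δ : ℝ) : ℕ∞ :=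
  sInf ((fun t : ℕ => (t : ℕ∞)) '' {t : ℕ | 0 < t ∧ (numUnhappy v₀ g t : ℝ) ≤ √(n : ℝ) / δ})

/-- The random variables `G i t` are independent and uniformly distributed on the `n` vertices. -/
structure IsUniformMoves {Ω : Type*} [MeasurableSpace Ω] (P : Measure Ω) {n M : ℕ}
    (G : Fin M → ℕ → Ω → Fin n) : Prop where
  measurable : ∀ i t, Measurable (G i t)
  indep : iIndepFun (fun x : Fin M × ℕ => G x.1 x.2) P
  uniform : ∀ i t v, P.real {ω | G i t ω = v} = 1 / (n : ℝ)

end Dispersion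

/-! At density M ≈ n/2 the process follows a deterministic recursion. If xn particles are unhappy,
the (1/2 - x)n vertices holding a happy particle stay lone with probability about exp(-x), and each
of the other (1/2 + x)n vertices receives exactly one mover with probability about x exp(-x). So
about `drift x * n` particles are unhappy next, and `drift x = x - (7/4)x² + O(x³)`. For the orbit
`fluid` started at 1/2, the reciprocals grow by 7/4 per step asymptotically. Hence `fluid t ~
4/(7t)`, the level 1/(δ√n) is crossed near t = (4/7)δ√n, and the partial sums are (4/7) log T + c +
o(1) (`exists_tendsto_sum_fluid_sub_log`).

The random process must track this orbit for N = ⌊δ√n⌋ steps in relative error. The decisive fact is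
`abs_drift_sub_drift_mul_le`: one application of `drift` does not increase a relative error. What
each step adds is a bias of relative size O(1/√n), from M - n/2 and from replacing powers by
exponentials, and a fluctuation of variance O(u), by bounded differences. Since 1/`fluid t` = O(N),
the squared relative error gains O(N/n) per step in mean and is O(N²/n) = O(δ²) overall
(`expect_relDev_sq_le`, `integral_relDev_sq_le`). Stopping at a level gives a maximal inequality,
and Cauchy–Schwarz controls the cumulated error. Both failure probabilities are O(δ²) for fixed ε,
hence at most δ/2 together for small δ.

The hitting time and the total then follow from the orbit. The overshoot needs a finer scale:
subgaussian tails show that, with high probability, every step is within n^(1/16)√u of its mean, so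
the level √n/δ is undershot by a relative amount of at most n^(-1/8), uniformly in all parameters.
-/

namespace Dispersion

open scoped BigOperators

/-! ### The fluid limit -/

/-- The fluid limit of one step at density one half: if a fraction `x` of `n` vertices' worth of
particles is unhappy, about `drift x * n` particles are unhappy after the next step. -/
noncomputable def drift (x : ℝ) : ℝ := 1 / 2 - Real.exp (-x) * (1 / 2 - x / 2 + x ^ 2)

@[simp]
lemma drift_zero : drift 0 = 0 := by simp [drift]

lemma hasDerivAt_drift (x : ℝ) :
    HasDerivAt drift (Real.exp (-x) * ((x - 1 / 2) * (x - 2))) x := by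
  have h1 : HasDerivAt (fun y : ℝ => Real.exp (-y)) (Real.exp (-x) * (-1)) x :=
    (hasDerivAt_neg x).exp
  have h2 : HasDerivAt (fun y : ℝ => 1 / 2 - y / 2 + y ^ 2) (-(1 / 2) + 2 * x) x := by
    have := (((hasDerivAt_id x).div_const 2).const_sub (1 / 2)).add ((hasDerivAt_id x).pow 2)
    exact this.congr_deriv (by simp)
  exact ((h1.mul h2).const_sub (1 / 2)).congr_deriv (by ring)

lemma deriv_drift : deriv drift = fun x => Real.exp (-x) * ((x - 1 / 2) * (x - 2)) :=
  funext fun x => (hasDerivAt_drift x).deriv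

lemma continuous_drift : Continuous drift :=
  continuous_iff_continuousAt.2 fun x => (hasDerivAt_drift x).continuousAt

lemma concaveOn_drift : ConcaveOn ℝ (Set.Icc 0 1) drift := by
  have h2 : ∀ x : ℝ, HasDerivAt (fun x : ℝ => Real.exp (-x) * ((x - 1 / 2) * (x - 2)))
      (-(Real.exp (-x) * ((x - 1) * (x - 7 / 2)))) x := by
    intro x
    have h1 : HasDerivAt (fun y : ℝ => Real.exp (-y)) (Real.exp (-x) * (-1)) x :=
      (hasDerivAt_neg x).exp
    have h2 := ((hasDerivAt_id x).sub_const (1 / 2)).mul ((hasDerivAt_id x).sub_const 2)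
    exact (h1.mul h2).congr_deriv (by simp only [id, Pi.mul_apply]; ring)
  refine concaveOn_of_deriv2_nonpos (convex_Icc 0 1) continuous_drift.continuousOn
    (fun x _ => (hasDerivAt_drift x).differentiableAt.differentiableWithinAt) ?_ ?_
  · rw [deriv_drift]
    exact fun x _ => (h2 x).differentiableAt.differentiableWithinAt
  · intro x hx
    rw [interior_Icc] at hx
    simp only [Function.iterate_succ, Function.iterate_zero, Function.comp, id, deriv_drift,
      (h2 x).deriv]
    have := Real.exp_pos (-x)
    have : 0 ≤ (x - 1) * (x - 7 / 2) := by nlinarith [hx.1, hx.2]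
    simp only [neg_nonpos]
    positivity

/-- Concavity together with `drift 0 = 0` makes `drift x / x` nonincreasing. -/
lemma mul_drift_le {X x : ℝ} (hX : 0 ≤ X) (hXx : X ≤ x) (hx : x ≤ 1) :
    X * drift x ≤ x * drift X := by
  rcases hX.eq_or_lt with rfl | hX0
  · simp
  have hx0 : 0 < x := hX0.trans_le hXx
  have h := concaveOn_drift.2 (show (x : ℝ) ∈ Set.Icc 0 1 from ⟨hx0.le, hx⟩)
    (show (0 : ℝ) ∈ Set.Icc 0 1 by simp) (show 0 ≤ X / x by positivity)
    (show 0 ≤ 1 - X / x by rw [sub_nonneg, div_le_one hx0]; exact hXx) (by ring)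
  simp only [smul_eq_mul, drift_zero, mul_zero, add_zero] at h
  rw [div_mul_cancel₀ _ hx0.ne', div_mul_eq_mul_div, div_le_iff₀ hx0] at h
  linarith

/-- On [0, 1/2] the concave graph lies above its chord, whose slope is at least 1/3 because `drift
(1/2) = (1 - exp (-1/2)) / 2`. -/
lemma third_le_drift {x : ℝ} (hx : 0 ≤ x) (hx2 : x ≤ 1 / 2) : x / 3 ≤ drift x := by
  have h := mul_drift_le hx hx2 (by norm_num)
  have h3 : Real.exp (-(1 / 2)) ≤ 2 / 3 := by
    rw [Real.exp_neg, inv_le_comm₀ (Real.exp_pos _) (by norm_num)]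
    have := Real.add_one_le_exp (1 / 2 : ℝ)
    linarith
  have h4 : (1 / 6 : ℝ) ≤ drift (1 / 2) := by
    unfold drift
    linarith
  nlinarith

lemma drift_le {x : ℝ} (hx : 0 ≤ x) (hx2 : x ≤ 1 / 2) : drift x ≤ x - x ^ 2 := by
  have h := Real.add_one_le_exp (-x)
  have h2 : 0 ≤ 1 / 2 - x / 2 + x ^ 2 := by nlinarith
  unfold drift
  nlinarith [mul_le_mul_of_nonneg_right h h2, mul_nonneg (mul_nonneg hx hx) (sub_nonneg.2 hx2)]

/-- The quadratic coefficient 7/4 found here is the source of every 4/7 in the asymptotics. -/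
lemma abs_drift_sub_le {x : ℝ} (hx : 0 ≤ x) (hx1 : x ≤ 1) :
    |drift x - (x - 7 / 4 * x ^ 2)| ≤ 3 * x ^ 3 := by
  have h := Real.exp_bound (x := -x) (by rwa [abs_neg, abs_of_nonneg hx]) (n := 3) (by norm_num)
  norm_num [Finset.sum_range_succ, Nat.factorial, abs_of_nonneg hx] at h
  set e := Real.exp (-x) - (1 + -x + x ^ 2 / 2) with he
  have hexp : Real.exp (-x) = e + (1 + -x + x ^ 2 / 2) := by rw [he]; ring
  have h1 : drift x - (x - 7 / 4 * x ^ 2)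
      = x ^ 3 * (5 / 4 - x / 2) - e * (1 / 2 - x / 2 + x ^ 2) := by
    unfold drift
    rw [hexp]
    ring
  have h2 : 0 ≤ 1 / 2 - x / 2 + x ^ 2 := by nlinarith [sq_nonneg (x - 1 / 4)]
  have h3 : 1 / 2 - x / 2 + x ^ 2 ≤ 3 / 2 := by nlinarith
  have hx3 : 0 ≤ x ^ 3 := by positivity
  rw [h1]
  calc _ ≤ |x ^ 3 * (5 / 4 - x / 2)| + |e * (1 / 2 - x / 2 + x ^ 2)| := abs_sub _ _
    _ ≤ x ^ 3 * (5 / 4) + x ^ 3 * (2 / 9) * (3 / 2) := by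
        rw [abs_mul, abs_mul, abs_of_nonneg hx3, abs_of_nonneg h2,
          abs_of_nonneg (show 0 ≤ 5 / 4 - x / 2 by linarith)]
        gcongr
        linarith
    _ ≤ _ := by linarith

lemma le_drift {x : ℝ} (hx : 0 ≤ x) (hx1 : x ≤ 1) : x - 7 / 4 * x ^ 2 ≤ drift x := by
  have hexp : Real.exp (-x) ≤ 1 - x + x ^ 2 / 2 := by
    have h0 : 0 ≤ 1 - x + x ^ 2 / 2 := by nlinarith
    have h1 : 1 + x + x ^ 2 / 2 + x ^ 3 / 6 ≤ Real.exp x := by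
      have := Real.sum_le_exp_of_nonneg hx 4
      norm_num [Finset.sum_range_succ, Nat.factorial] at this
      linarith
    rw [Real.exp_neg, inv_le_iff_one_le_mul₀ (Real.exp_pos _)]
    have h2 := mul_le_mul_of_nonneg_left h1 h0
    have h3 : 0 ≤ x ^ 3 := by positivity
    have h4 : 0 ≤ x ^ 4 := by positivity
    have h5 : 0 ≤ x ^ 5 := by positivity
    nlinarith
  have h2 : 0 ≤ 1 / 2 - x / 2 + x ^ 2 := by nlinarith [sq_nonneg (x - 1 / 4)]
  have h3 : 0 ≤ x ^ 3 := by positivity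
  have := mul_le_mul_of_nonneg_right hexp h2
  unfold drift
  nlinarith

lemma monotoneOn_drift : MonotoneOn drift (Set.Icc 0 (1 / 2)) := by
  refine monotoneOn_of_deriv_nonneg (convex_Icc _ _) continuous_drift.continuousOn
    (fun x _ => (hasDerivAt_drift x).differentiableAt.differentiableWithinAt) ?_
  intro x hx
  rw [interior_Icc] at hx
  rw [(hasDerivAt_drift x).deriv]
  have : 0 ≤ (x - 1 / 2) * (x - 2) := by nlinarith [hx.1, hx.2]
  have := Real.exp_pos (-x)
  positivity

/-- Since M may exceed n/2, the chord estimate must reach past the critical point 1/2, where the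
drift starts to decrease. On the range needed its slope stays above -1/3, which matches the constant
of `third_le_drift`. -/
lemma monotoneOn_drift_add : MonotoneOn (fun x => drift x + x / 3) (Set.Icc 0 (3 / 5)) := by
  have hd : ∀ x, HasDerivAt (fun x => drift x + x / 3)
      (Real.exp (-x) * ((x - 1 / 2) * (x - 2)) + 1 / 3) x := fun x =>
    (hasDerivAt_drift x).add ((hasDerivAt_id x).div_const 3)
  refine monotoneOn_of_deriv_nonneg (convex_Icc _ _)
    (continuous_drift.add (by fun_prop)).continuousOn
    (fun x _ => (hd x).differentiableAt.differentiableWithinAt) ?_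
  intro x hx
  rw [interior_Icc] at hx
  rw [(hd x).deriv]
  have h1 : -(1 / 3) ≤ (x - 1 / 2) * (x - 2) := by nlinarith [hx.1, hx.2]
  have h2 := Real.exp_pos (-x)
  have h3 : Real.exp (-x) ≤ 1 := Real.exp_le_one_iff.2 (by linarith [hx.1])
  nlinarith

/-- The chord slopes of `drift` at `x` are bounded by `drift x / x`. -/
lemma abs_drift_sub_drift_mul_le {x X : ℝ} (hx : 0 ≤ x) (hx2 : x ≤ 1 / 2) (hX : 0 ≤ X)
    (hX2 : X ≤ 3 / 5) : |drift X - drift x| * x ≤ drift x * |X - x| := by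
  rcases le_total X x with h | h
  · have h1 := monotoneOn_drift ⟨hX, h.trans hx2⟩ ⟨hx, hx2⟩ h
    have h2 := mul_drift_le hX h (by linarith)
    rw [abs_of_nonpos (by linarith), abs_of_nonpos (by linarith)]
    linarith
  -- For X above x, concavity bounds the increase; a decrease is at most (X - x)/3, and 1/3 is at
  -- most `drift x / x`.
  · rw [abs_of_nonneg (a := X - x) (by linarith)]
    have h2 := mul_drift_le hx h (by linarith)
    have h3 := monotoneOn_drift_add ⟨hx, by linarith⟩ ⟨hX, hX2⟩ h
    simp only at h3
    have h4 := third_le_drift hx hx2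
    rcases abs_cases (drift X - drift x) with ⟨h5, -⟩ | ⟨h5, -⟩ <;> rw [h5]
    · linarith
    · nlinarith [mul_le_mul_of_nonneg_right h4 (sub_nonneg.2 h),
        mul_le_mul_of_nonneg_right h3 hx]

/-! ### Asymptotics of the orbit of the drift -/

/-- The fluid limit of the fraction of unhappy particles. -/
noncomputable def fluid : ℕ → ℝ
  | 0 => 1 / 2
  | t + 1 => drift (fluid t)

lemma fluid_mem (t : ℕ) : 0 < fluid t ∧ fluid t ≤ 1 / 2 := by
  induction t with
  | zero => norm_num [fluid]
  | succ t ih =>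
    have h1 := third_le_drift ih.1.le ih.2
    have h2 := drift_le ih.1.le ih.2
    constructor
    · exact lt_of_lt_of_le (by linarith [ih.1]) h1
    · exact h2.trans (by nlinarith [ih.1, ih.2])

lemma fluid_pos (t : ℕ) : 0 < fluid t := (fluid_mem t).1

lemma fluid_le_half (t : ℕ) : fluid t ≤ 1 / 2 := (fluid_mem t).2

lemma fluid_le_three_mul_succ (t : ℕ) : fluid t ≤ 3 * fluid (t + 1) := by
  have := third_le_drift (fluid_pos t).le (fluid_le_half t)
  simp only [fluid]
  linarith

lemma antitone_fluid : Antitone fluid := by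
  refine antitone_nat_of_succ_le fun t => ?_
  have := drift_le (fluid_pos t).le (fluid_le_half t)
  simp only [fluid]
  nlinarith [sq_nonneg (fluid t)]

lemma inv_fluid_succ_sub (t : ℕ) : (fluid (t + 1))⁻¹ - (fluid t)⁻¹
    = (fluid t - fluid (t + 1)) / (fluid t * fluid (t + 1)) := by
  have h1 := fluid_pos t
  have h2 := fluid_pos (t + 1)
  field_simp

/-- For consecutive values x ≥ y of the orbit, x - y ≥ x² ≥ xy. With the upper bound on the
increments this makes the orbit of exact order 1/t. -/
lemma one_le_inv_fluid_succ_sub (t : ℕ) : 1 ≤ (fluid (t + 1))⁻¹ - (fluid t)⁻¹ := by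
  have h1 := fluid_pos t
  have h2 := fluid_pos (t + 1)
  have h3 := drift_le h1.le (fluid_le_half t)
  have h4 : fluid (t + 1) ≤ fluid t := antitone_fluid t.le_succ
  rw [inv_fluid_succ_sub, one_le_div (by positivity)]
  have : drift (fluid t) = fluid (t + 1) := rfl
  nlinarith

lemma inv_fluid_succ_sub_le (t : ℕ) : (fluid (t + 1))⁻¹ - (fluid t)⁻¹ ≤ 6 := by
  have h1 := fluid_pos t
  have h2 := fluid_pos (t + 1)
  have h3 := le_drift h1.le (by linarith [fluid_le_half t])
  have h4 := fluid_le_three_mul_succ t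
  rw [inv_fluid_succ_sub, div_le_iff₀ (by positivity)]
  have : drift (fluid t) = fluid (t + 1) := rfl
  nlinarith

lemma fluid_le (t : ℕ) : fluid t ≤ 1 / (t + 2) := by
  have h : (t : ℝ) + 2 ≤ (fluid t)⁻¹ := by
    induction t with
    | zero => norm_num [fluid]
    | succ t ih =>
      have := one_le_inv_fluid_succ_sub t
      push_cast
      linarith
  rw [one_div]
  exact (le_inv_comm₀ (by positivity) (fluid_pos t)).1 h

lemma inv_fluid_le (t : ℕ) : (fluid t)⁻¹ ≤ 6 * (t + 1) := by
  induction t with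
  | zero => norm_num [fluid]
  | succ t ih =>
    have := inv_fluid_succ_sub_le t
    push_cast
    linarith

lemma tendsto_fluid : Tendsto fluid atTop (𝓝 0) := by
  refine squeeze_zero (fun t => (fluid_pos t).le) (fun t => (fluid_le t).trans ?_)
    tendsto_one_div_add_atTop_nhds_zero_nat
  gcongr
  norm_num

lemma tendsto_drift_div : Tendsto (fun x => drift x / x) (𝓝[>] 0) (𝓝 1) := by
  have h := ((hasDerivAt_drift 0).tendsto_slope_zero_right)
  simp only [zero_add, drift_zero, sub_zero, smul_eq_mul] at h
  norm_num at h
  refine h.congr fun x => ?_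
  rw [div_eq_inv_mul]

lemma tendsto_fluid_nhdsGT : Tendsto fluid atTop (𝓝[>] 0) :=
  tendsto_nhdsWithin_iff.2 ⟨tendsto_fluid, Eventually.of_forall fun t => fluid_pos t⟩

/-- The increment is (x - y)/x² divided by y/x; the quotients tend to 7/4 and to 1. -/
lemma tendsto_inv_fluid_succ_sub :
    Tendsto (fun t => (fluid (t + 1))⁻¹ - (fluid t)⁻¹) atTop (𝓝 (7 / 4)) := by
  have h1 : Tendsto (fun t => (fluid t - fluid (t + 1)) / fluid t ^ 2) atTop (𝓝 (7 / 4)) := by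
    rw [tendsto_iff_norm_sub_tendsto_zero]
    have h0 := tendsto_fluid.const_mul 3
    rw [mul_zero] at h0
    refine squeeze_zero (fun t => norm_nonneg _) (fun t => ?_) h0
    have h1 := fluid_pos t
    have h2 := abs_drift_sub_le h1.le (by linarith [fluid_le_half t])
    have h3 : (fluid t - fluid (t + 1)) / fluid t ^ 2 - 7 / 4
        = -(drift (fluid t) - (fluid t - 7 / 4 * fluid t ^ 2)) / fluid t ^ 2 := by
      simp only [fluid]
      field_simp
      ring
    rw [Real.norm_eq_abs, h3, abs_div, abs_neg, abs_of_pos (show 0 < fluid t ^ 2 by positivity),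
      div_le_iff₀ (by positivity)]
    linarith
  have h2 : Tendsto (fun t => fluid (t + 1) / fluid t) atTop (𝓝 1) :=
    tendsto_drift_div.comp tendsto_fluid_nhdsGT
  have h3 := h1.div h2 one_ne_zero
  rw [div_one] at h3
  refine h3.congr fun t => ?_
  have h1 := fluid_pos t
  have h2 := fluid_pos (t + 1)
  simp only [Pi.div_apply]
  field_simp

/-- Cesàro averaging of the reciprocal increments gives 1/(t · `fluid t`) → 7/4. -/
lemma tendsto_mul_fluid : Tendsto (fun t : ℕ => (t : ℝ) * fluid t) atTop (𝓝 (4 / 7)) := by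
  have h1 := tendsto_inv_fluid_succ_sub.cesaro
  have h2 : Tendsto (fun t : ℕ => (t : ℝ)⁻¹ * (fluid t)⁻¹) atTop (𝓝 (7 / 4)) := by
    have h3 := h1.add (tendsto_inv_atTop_nhds_zero_nat (𝕜 := ℝ) |>.mul_const 2)
    rw [zero_mul, add_zero] at h3
    refine h3.congr fun t => ?_
    rw [Finset.sum_range_sub (fun i => (fluid i)⁻¹)]
    norm_num [fluid]
    ring
  have h3 := h2.inv₀ (by norm_num)
  refine (h3.congr fun t => ?_).trans (by norm_num)
  rw [mul_inv, inv_inv, inv_inv]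

/-- With x, y consecutive, log(x/y) lies between 1 - y/x and x/y - 1, both equal to (7/4)x + O(x²).
The terms are thus O(x²) = O(1/t²), while the logarithms telescope. -/
lemma summable_fluid_sub :
    Summable fun t => fluid t - 4 / 7 * Real.log (fluid t / fluid (t + 1)) := by
  have hs : Summable fun t : ℕ => 20 * (1 / ((t : ℝ) + 1) ^ 2) := by
    have := (summable_nat_add_iff 1).2 (Real.summable_one_div_nat_pow.2 (one_lt_two))
    simpa using this.mul_left 20
  refine hs.of_norm_bounded fun t => ?_
  have h1 := fluid_pos t
  have h2 := fluid_pos (t + 1)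
  have hh := fluid_le_half t
  set x := fluid t with hx
  have hy : fluid (t + 1) = drift x := rfl
  rw [hy] at h2 ⊢
  have h3 := abs_le.1 (abs_drift_sub_le h1.le (by linarith))
  have h4 := third_le_drift h1.le hh
  have hxt : x ≤ 1 / ((t : ℝ) + 1) := (fluid_le t).trans (by gcongr; norm_num)
  have hup : Real.log (x / drift x) ≤ x / drift x - 1 :=
    Real.log_le_sub_one_of_pos (by positivity)
  have hlo : 1 - drift x / x ≤ Real.log (x / drift x) := by
    have := Real.log_le_sub_one_of_pos (show 0 < drift x / x by positivity)
    rw [← inv_div x, Real.log_inv] at this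
    rw [← inv_div x]
    linarith
  have hup2 : x / drift x - 1 ≤ 7 / 4 * x + 35 * x ^ 2 := by
    rw [div_sub_one h2.ne', div_le_iff₀ h2]
    nlinarith [mul_le_mul_of_nonneg_left h4 (show 0 ≤ 7 / 4 * x + 35 * x ^ 2 by positivity),
      mul_le_mul_of_nonneg_left h3.1 (show 0 ≤ 7 / 4 * x by positivity), pow_pos h1 2, pow_pos h1 3,
      pow_pos h1 4]
  have hlo2 : 7 / 4 * x - 3 * x ^ 2 ≤ 1 - drift x / x := by
    rw [one_sub_div h1.ne', le_div_iff₀ h1]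
    nlinarith
  have hx2 : x ^ 2 ≤ 1 / ((t : ℝ) + 1) ^ 2 := by
    rw [← one_div_pow]
    gcongr
  rw [Real.norm_eq_abs]
  refine le_trans ?_ (mul_le_mul_of_nonneg_left hx2 (by norm_num : (0 : ℝ) ≤ 20))
  rw [abs_le]
  constructor <;> nlinarith

/-- The cumulated fluid limit grows logarithmically, up to a convergent constant. -/
lemma exists_tendsto_sum_fluid_sub_log : ∃ c : ℝ, Tendsto
    (fun T : ℕ => ∑ t ∈ Finset.range (T + 1), fluid t - 4 / 7 * Real.log T) atTop (𝓝 c) := by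
  obtain ⟨c, hc⟩ := summable_fluid_sub
  have h1 := hc.tendsto_sum_nat
  have h2 : Tendsto (fun T : ℕ => Real.log (T * fluid T)) atTop (𝓝 (Real.log (4 / 7))) :=
    tendsto_mul_fluid.log (by norm_num)
  have h3 := ((h1.add tendsto_fluid).add_const (4 / 7 * Real.log (1 / 2))).sub
    (h2.const_mul (4 / 7))
  refine ⟨_, h3.congr' ?_⟩
  filter_upwards [eventually_ge_atTop 1] with T hT
  have hlog : ∑ t ∈ Finset.range T, Real.log (fluid t / fluid (t + 1))
      = Real.log (1 / 2) - Real.log (fluid T) := by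
    have : ∀ t, Real.log (fluid t / fluid (t + 1))
        = Real.log (fluid t) - Real.log (fluid (t + 1)) := fun t =>
      Real.log_div (fluid_pos t).ne' (fluid_pos (t + 1)).ne'
    simp only [this]
    rw [Finset.sum_range_sub']
    rfl
  rw [Finset.sum_sub_distrib, ← Finset.mul_sum, hlog, Finset.sum_range_succ,
    Real.log_mul (by positivity) (fluid_pos T).ne']
  ring

/-! ### Concentration for finite averages -/

/-- This turns bounds on exponential moments at l and -l into a second moment bound. -/
lemma one_add_sq_div_two_le_cosh (y : ℝ) : 1 + y ^ 2 / 2 ≤ Real.cosh y := by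
  have h1 := Real.cosh_two_mul (y / 2)
  have h2 := Real.cosh_sq (y / 2)
  have h3 : (y / 2) ^ 2 ≤ Real.sinh (y / 2) ^ 2 := by
    rw [sq_le_sq, Real.abs_sinh]
    exact Real.self_le_sinh_iff.2 (abs_nonneg _)
  rw [mul_div_cancel₀ _ two_ne_zero] at h1
  nlinarith

section Expect

variable {β : Type*} [Fintype β]

lemma expect_mono {f g : β → ℝ} (h : ∀ b, f b ≤ g b) : 𝔼 b, f b ≤ 𝔼 b, g b :=
  Finset.expect_le_expect fun b _ => h b

lemma expect_fin_cons {m : ℕ} (f : (Fin (m + 1) → β) → ℝ) :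
    𝔼 a, f a = 𝔼 b : β, 𝔼 a : Fin m → β, f (Fin.cons b a) := by
  rw [← Finset.expect_product' Finset.univ Finset.univ (fun b a => f (Fin.cons b a)),
    Finset.univ_product_univ]
  refine (Fintype.expect_equiv (Fin.consEquiv (fun _ => β)) _ _ fun x => ?_).symm
  rfl

/-- A tail bound from a subgaussian exponential moment bound. -/
lemma expect_tail_le_of_expect_exp_le (Y : β → ℝ) {v s : ℝ} (hv : 0 < v) (hs : 0 ≤ s)
    (h : ∀ l : ℝ, 𝔼 b, Real.exp (l * Y b) ≤ Real.exp (2 * l ^ 2 * v)) :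
    𝔼 b, (if s ≤ |Y b| then (1 : ℝ) else 0) ≤ 2 * Real.exp (-(s ^ 2 / (8 * v))) := by
  -- Minimizer of the Chernoff exponent 2l²v - ls.
  set l := s / (4 * v) with hl
  have hl0 : 0 ≤ l := by positivity
  have h1 : ∀ b, (if s ≤ |Y b| then (1 : ℝ) else 0) ≤
      Real.exp (-(l * s)) * (Real.exp (l * Y b) + Real.exp (-l * Y b)) := by
    intro b
    split_ifs with hb
    · rw [mul_add, ← Real.exp_add, ← Real.exp_add]
      rcases abs_cases (Y b) with ⟨h5, -⟩ | ⟨h5, -⟩ <;> rw [h5] at hb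
      · have : 1 ≤ Real.exp (-(l * s) + l * Y b) := Real.one_le_exp (by nlinarith)
        linarith [Real.exp_pos (-(l * s) + -l * Y b)]
      · have : 1 ≤ Real.exp (-(l * s) + -l * Y b) := Real.one_le_exp (by nlinarith)
        linarith [Real.exp_pos (-(l * s) + l * Y b)]
    · positivity
  have h2 := expect_mono h1
  rw [← Finset.mul_expect, Finset.expect_add_distrib] at h2
  have h3 := h l
  have h4 := h (-l)
  rw [neg_sq] at h4
  calc _ ≤ Real.exp (-(l * s)) * (Real.exp (2 * l ^ 2 * v) + Real.exp (2 * l ^ 2 * v)) :=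
        h2.trans (by gcongr)
    _ = 2 * (Real.exp (-(l * s)) * Real.exp (2 * l ^ 2 * v)) := by ring
    _ = _ := by
        rw [← Real.exp_add, hl]
        congr 2
        field_simp
        ring

variable [Nonempty β]

lemma expect_sub_expect_self (f : β → ℝ) : 𝔼 b, (f b - 𝔼 c, f c) = 0 := by
  rw [Finset.expect_sub_distrib, Fintype.expect_const, sub_self]

lemma exp_expect_le (f : β → ℝ) : Real.exp (𝔼 b, f b) ≤ 𝔼 b, Real.exp (f b) := by
  set m := 𝔼 b, f b with hm
  have h : ∀ b, Real.exp m * (1 + (f b - m)) ≤ Real.exp (f b) := by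
    intro b
    have h1 := Real.add_one_le_exp (f b - m)
    calc _ ≤ Real.exp m * Real.exp (f b - m) := by gcongr; linarith
      _ = _ := by rw [← Real.exp_add]; ring_nf
  calc Real.exp m = 𝔼 b, Real.exp m * (1 + (f b - m)) := by
        rw [← Finset.mul_expect, Finset.expect_add_distrib, Fintype.expect_const,
          expect_sub_expect_self, add_zero, mul_one]
    _ ≤ _ := expect_mono h

/-- Hoeffding's lemma for a uniformly distributed variable, by symmetrization. -/
lemma expect_exp_sub_expect_le (f : β → ℝ) (c l : ℝ) (h : ∀ b b', |f b - f b'| ≤ c) :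
    𝔼 b, Real.exp (l * (f b - 𝔼 b', f b')) ≤ Real.exp (l ^ 2 * c ^ 2 / 2) := by
  have h1 : ∀ b, Real.exp (l * (f b - 𝔼 b', f b')) ≤ 𝔼 b', Real.exp (l * (f b - f b')) := by
    intro b
    convert exp_expect_le (fun b' => l * (f b - f b')) using 2
    rw [← Finset.mul_expect, Finset.expect_sub_distrib, Fintype.expect_const]
  -- Exchanging the two independent copies flips the sign, so exp may be replaced by cosh, which is
  -- at most exp of half the square.
  have h2 : 𝔼 b, 𝔼 b', Real.exp (l * (f b - f b')) = 𝔼 b, 𝔼 b', Real.cosh (l * (f b - f b')) := by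
    have h3 : 𝔼 b, 𝔼 b', Real.exp (l * (f b - f b')) = 𝔼 b, 𝔼 b', Real.exp (-(l * (f b - f b'))) := by
      rw [Finset.expect_comm]
      refine Finset.expect_congr rfl fun b _ => Finset.expect_congr rfl fun b' _ => ?_
      congr 1
      ring
    simp only [Real.cosh_eq, ← Finset.expect_div, Finset.expect_add_distrib]
    rw [← h3]
    ring
  calc _ ≤ 𝔼 b, 𝔼 b', Real.exp (l * (f b - f b')) := expect_mono h1
    _ = 𝔼 b, 𝔼 b', Real.cosh (l * (f b - f b')) := h2
    _ ≤ 𝔼 _b : β, 𝔼 _b' : β, Real.exp (l ^ 2 * c ^ 2 / 2) := by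
        refine expect_mono fun b => expect_mono fun b' => (Real.cosh_le_exp_half_sq _).trans ?_
        rw [mul_pow]
        have : (f b - f b') ^ 2 ≤ c ^ 2 := sq_le_sq' (abs_le.1 (h b b')).1 (abs_le.1 (h b b')).2
        gcongr
    _ = _ := by rw [Fintype.expect_const, Fintype.expect_const]

/-- The bounded differences inequality, in exponential moment form. -/
theorem expect_exp_le_of_bounded_differences {m : ℕ} (f : (Fin m → β) → ℝ) (c : Fin m → ℝ) (l : ℝ)
    (h : ∀ i a b, |f (Function.update a i b) - f a| ≤ c i) :
    𝔼 a, Real.exp (l * (f a - 𝔼 a', f a')) ≤ Real.exp (l ^ 2 * (∑ i, c i ^ 2) / 2) := by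
  induction m with
  | zero => simp
  | succ m ih =>
    -- Averaging out all coordinates but the first: induction handles the deviation from `g`,
    -- Hoeffding's lemma the fluctuation of `g` itself.
    set g : β → ℝ := fun b => 𝔼 a : Fin m → β, f (Fin.cons b a) with hg
    have hfg : 𝔼 a', f a' = 𝔼 b, g b := expect_fin_cons f
    have hin : ∀ b, 𝔼 a : Fin m → β, Real.exp (l * (f (Fin.cons b a) - g b))
        ≤ Real.exp (l ^ 2 * (∑ i : Fin m, c i.succ ^ 2) / 2) := by
      intro b
      refine ih (fun a => f (Fin.cons b a)) (fun i => c i.succ) fun i a b' => ?_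
      rw [Fin.cons_update]
      exact h _ _ _
    have hout : ∀ b b', |g b - g b'| ≤ c 0 := by
      intro b b'
      rw [hg, ← Finset.expect_sub_distrib]
      refine (Finset.abs_expect_le _ _).trans ?_
      calc _ ≤ 𝔼 _a : Fin m → β, c 0 := expect_mono fun a => ?_
        _ = c 0 := Fintype.expect_const _
      have := h 0 (Fin.cons b' a) b
      rwa [Fin.update_cons_zero] at this
    calc _ = 𝔼 b : β, Real.exp (l * (g b - 𝔼 b', g b')) *
          𝔼 a : Fin m → β, Real.exp (l * (f (Fin.cons b a) - g b)) := by
          rw [expect_fin_cons, hfg]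
          refine Finset.expect_congr rfl fun b _ => ?_
          rw [Finset.mul_expect]
          refine Finset.expect_congr rfl fun a _ => ?_
          rw [← Real.exp_add]
          congr 1
          ring
      _ ≤ 𝔼 b : β, Real.exp (l * (g b - 𝔼 b', g b')) *
          Real.exp (l ^ 2 * (∑ i : Fin m, c i.succ ^ 2) / 2) :=
          expect_mono fun b => mul_le_mul_of_nonneg_left (hin b) (Real.exp_pos _).le
      _ ≤ Real.exp (l ^ 2 * c 0 ^ 2 / 2) * Real.exp (l ^ 2 * (∑ i : Fin m, c i.succ ^ 2) / 2) := by
          rw [← Finset.expect_mul]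
          gcongr
          exact expect_exp_sub_expect_le g (c 0) l hout
      _ = _ := by
          rw [← Real.exp_add, Fin.sum_univ_succ]
          congr 1
          ring

/-- A variance bound from a subgaussian exponential moment bound. -/
lemma expect_sq_le_of_expect_exp_le (Y : β → ℝ) {v : ℝ} (hv : 0 ≤ v)
    (h : ∀ l : ℝ, 𝔼 b, Real.exp (l * Y b) ≤ Real.exp (2 * l ^ 2 * v)) :
    𝔼 b, Y b ^ 2 ≤ 8 * v := by
  have key : ∀ l : ℝ, l ^ 2 * 𝔼 b, Y b ^ 2 ≤ 2 * (Real.exp (2 * l ^ 2 * v) - 1) := by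
    intro l
    have h1 : ∀ b, l ^ 2 * Y b ^ 2 + 2 ≤ Real.exp (l * Y b) + Real.exp (-l * Y b) := by
      intro b
      have := one_add_sq_div_two_le_cosh (l * Y b)
      rw [Real.cosh_eq] at this
      rw [neg_mul]
      nlinarith
    have h2 := expect_mono h1
    rw [Finset.expect_add_distrib, Finset.expect_add_distrib, Fintype.expect_const,
      ← Finset.mul_expect] at h2
    have h3 := h l
    have h4 := h (-l)
    rw [neg_sq] at h4
    linarith
  rcases hv.eq_or_lt with rfl | hv
  · have := key 1
    simp at this
    linarith
  -- This l makes the exponent equal to 1; the resulting constant 4(e - 1) is below 8.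
  · have h1 := key (√(1 / (2 * v)))
    rw [Real.sq_sqrt (by positivity)] at h1
    have h2 : 2 * (1 / (2 * v)) * v = 1 := by field_simp
    rw [h2, one_div_mul_eq_div, div_le_iff₀ (by positivity)] at h1
    nlinarith [Real.exp_one_lt_d9]

/-- The mean square distance to a point splits into variance and squared bias. -/
lemma expect_sub_sq (f : β → ℝ) (y : ℝ) :
    𝔼 b, (f b - y) ^ 2 = 𝔼 b, (f b - 𝔼 c, f c) ^ 2 + (𝔼 c, f c - y) ^ 2 := by
  set m := 𝔼 c, f c with hm
  have h : ∀ b, (f b - y) ^ 2 = (f b - m) ^ 2 + (2 * (m - y)) * (f b - m) + (m - y) ^ 2 := by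
    intro b
    ring
  simp only [h]
  rw [Finset.expect_add_distrib, Finset.expect_add_distrib, ← Finset.mul_expect,
    expect_sub_expect_self, Fintype.expect_const]
  ring

end Expect

/-! ### One step of the process -/

/-- The positions after the particles of `S` have moved according to `a`. -/
def moved {n M : ℕ} (p : Fin M → Fin n) (S : Finset (Fin M)) (a : Fin M → Fin n) : Fin M → Fin n :=
  fun i => if i ∈ S then a i else p i

/-- The vertices occupied by exactly one particle. -/
def lone {n M : ℕ} (p : Fin M → Fin n) : Finset (Fin n) := {v | ∃ i, ∀ j, p j = v ↔ j = i}

section OneStep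

variable {n M : ℕ}

lemma mem_lone {p : Fin M → Fin n} {v : Fin n} : v ∈ lone p ↔ ∃ i, ∀ j, p j = v ↔ j = i := by
  simp [lone]

lemma mem_collided {p : Fin M → Fin n} {i : Fin M} :
    i ∈ collided p ↔ ∃ j, j ≠ i ∧ p i = p j := by
  simp [collided]

lemma injOn_compl_collided (p : Fin M → Fin n) : Set.InjOn p ((collided p)ᶜ : Finset (Fin M)) := by
  intro i hi j _ hij
  by_contra hne
  simp only [Finset.coe_compl, Set.mem_compl_iff, Finset.mem_coe, mem_collided] at hi
  exact hi ⟨j, fun h => hne h.symm, hij⟩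

/-- Particles alone on their vertex correspond to lone vertices. Unhappy particles can thus be
counted vertex by vertex, where probabilities factor over the movers. -/
lemma card_collided (p : Fin M → Fin n) : (collided p).card + (lone p).card = M := by
  have h : lone p = ((collided p)ᶜ).image p := by
    ext v
    simp only [mem_lone, Finset.mem_image, Finset.mem_compl, mem_collided]
    constructor
    · rintro ⟨i, hi⟩
      refine ⟨i, ?_, (hi i).2 rfl⟩
      rintro ⟨j, hj, hij⟩
      exact hj ((hi j).1 (hij ▸ (hi i).2 rfl))
    · rintro ⟨i, hi, rfl⟩
      refine ⟨i, fun j => ⟨fun hj => ?_, fun hj => by rw [hj]⟩⟩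
      by_contra hne
      exact hi ⟨j, hne, hj.symm⟩
  rw [h, Finset.card_image_of_injOn (injOn_compl_collided p), Finset.card_add_card_compl,
    Fintype.card_fin]

/-- Relocating one particle affects only the vertex it leaves and the vertex it reaches. -/
lemma card_lone_le_of_eq_off (p p' : Fin M → Fin n) (i : Fin M) (h : ∀ j, j ≠ i → p j = p' j) :
    (lone p).card ≤ (lone p').card + 2 := by
  have hsub : lone p ⊆ lone p' ∪ {p i, p' i} := by
    intro v hv
    by_cases hvi : v = p i ∨ v = p' i
    · simp only [Finset.mem_union, Finset.mem_insert, Finset.mem_singleton]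
      exact Or.inr hvi
    · rw [not_or] at hvi
      refine Finset.mem_union_left _ ?_
      rw [mem_lone] at hv ⊢
      obtain ⟨k, hk⟩ := hv
      refine ⟨k, fun j => ?_⟩
      by_cases hj : j = i
      · subst hj
        refine ⟨fun h => absurd h.symm hvi.2, fun h => ?_⟩
        exact absurd ((hk j).2 h).symm hvi.1
      · rw [← h j hj]
        exact hk j
  calc _ ≤ (lone p' ∪ {p i, p' i}).card := Finset.card_le_card hsub
    _ ≤ (lone p').card + ({p i, p' i} : Finset (Fin n)).card := Finset.card_union_le _ _
    _ ≤ _ := by gcongr; exact Finset.card_le_two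

lemma abs_card_collided_sub_le (p p' : Fin M → Fin n) (i : Fin M) (h : ∀ j, j ≠ i → p j = p' j) :
    |((collided p).card : ℝ) - (collided p').card| ≤ 2 := by
  have h1 := card_lone_le_of_eq_off p p' i h
  have h2 := card_lone_le_of_eq_off p' p i fun j hj => (h j hj).symm
  have h3 := card_collided p
  have h4 := card_collided p'
  have h5 : (collided p).card ≤ (collided p').card + 2 := by omega
  have h6 : (collided p').card ≤ (collided p).card + 2 := by omega
  rw [abs_le]
  constructor
  · have : ((collided p').card : ℝ) ≤ (collided p).card + 2 := by exact_mod_cast h6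
    linarith
  · have : ((collided p).card : ℝ) ≤ (collided p').card + 2 := by exact_mod_cast h5
    linarith

lemma abs_card_collided_moved_update_sub_le (p : Fin M → Fin n) (S : Finset (Fin M)) (i : Fin M)
    (a : Fin M → Fin n) (b : Fin n) :
    |((collided (moved p S (Function.update a i b))).card : ℝ) - (collided (moved p S a)).card|
      ≤ if i ∈ S then 2 else 0 := by
  split_ifs with hi
  · refine abs_card_collided_sub_le _ _ i fun j hj => ?_
    simp [moved, Function.update_of_ne hj]
  · have : moved p S (Function.update a i b) = moved p S a := by
      funext j
      unfold moved
      split_ifs with hj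
      · rw [Function.update_of_ne]
        rintro rfl
        exact hi hj
      · rfl
    rw [this, sub_self, abs_zero]

/-- Exponential moments of the number of unhappy particles after one step. -/
lemma expect_exp_card_collided_moved_le [Nonempty (Fin n)] (p : Fin M → Fin n)
    (S : Finset (Fin M)) (l : ℝ) :
    𝔼 a, Real.exp (l * ((collided (moved p S a)).card - 𝔼 a', ((collided (moved p S a')).card : ℝ)))
      ≤ Real.exp (2 * l ^ 2 * S.card) := by
  refine (expect_exp_le_of_bounded_differences
    (fun a => ((collided (moved p S a)).card : ℝ)) (fun i => if i ∈ S then 2 else 0) l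
    (abs_card_collided_moved_update_sub_le p S)).trans_eq ?_
  congr 1
  simp only [ite_pow, ne_eq, OfNat.ofNat_ne_zero, not_false_eq_true, zero_pow]
  rw [Finset.sum_ite_mem, Finset.univ_inter, Finset.sum_const, nsmul_eq_mul]
  ring

lemma expect_prod_apply (f : Fin M → Fin n → ℝ) :
    𝔼 a : Fin M → Fin n, ∏ i, f i (a i) = ∏ i, 𝔼 v, f i v := by
  simp only [Fintype.expect_eq_sum_div_card]
  rw [Finset.prod_div_distrib, Finset.prod_const, Finset.card_univ, Fintype.card_fun,
    Finset.prod_univ_sum, Fintype.piFinset_univ]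
  simp

lemma expect_ite_eq_vertex (v : Fin n) :
    𝔼 w : Fin n, (if w = v then (1 : ℝ) else 0) = 1 / n := by
  rw [Fintype.expect_eq_sum_div_card, Finset.sum_ite_eq' Finset.univ v]
  simp

lemma expect_ite_ne_vertex (v : Fin n) :
    𝔼 w : Fin n, (if w ≠ v then (1 : ℝ) else 0) = 1 - 1 / n := by
  have : Nonempty (Fin n) := ⟨v⟩
  have h : ∀ w : Fin n, (if w ≠ v then (1 : ℝ) else 0) = 1 - if w = v then (1 : ℝ) else 0 := by
    intro w
    split_ifs <;> simp_all
  simp only [h]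
  rw [Finset.expect_sub_distrib, Fintype.expect_const, expect_ite_eq_vertex]

lemma expect_avoid (S : Finset (Fin M)) (v : Fin n) :
    𝔼 a : Fin M → Fin n, (if ∀ i ∈ S, a i ≠ v then (1 : ℝ) else 0) = (1 - 1 / n) ^ S.card := by
  have : Nonempty (Fin n) := ⟨v⟩
  have h : ∀ a : Fin M → Fin n, (if ∀ i ∈ S, a i ≠ v then (1 : ℝ) else 0)
      = ∏ i, (if i ∈ S then (if a i ≠ v then (1 : ℝ) else 0) else 1) := by
    intro a
    rw [Finset.prod_ite_mem, Finset.univ_inter, Finset.prod_ite_zero]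
    simp
  simp only [h]
  rw [expect_prod_apply fun i w => if i ∈ S then (if w ≠ v then (1 : ℝ) else 0) else 1]
  have h2 : ∀ i, 𝔼 w : Fin n, (if i ∈ S then (if w ≠ v then (1 : ℝ) else 0) else 1)
      = if i ∈ S then 1 - 1 / (n : ℝ) else 1 := by
    intro i
    split_ifs
    · exact expect_ite_ne_vertex v
    · exact Fintype.expect_const _
  simp only [h2]
  rw [Finset.prod_ite_mem, Finset.univ_inter, Finset.prod_const]

lemma expect_only (S : Finset (Fin M)) (v : Fin n) {i : Fin M} (hi : i ∈ S) :
    𝔼 a : Fin M → Fin n, (if ∀ j ∈ S, a j = v ↔ j = i then (1 : ℝ) else 0)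
      = 1 / n * (1 - 1 / n) ^ (S.card - 1) := by
  have : Nonempty (Fin n) := ⟨v⟩
  set f : Fin M → Fin n → ℝ := fun j w =>
    if j ∈ S then (if (w = v ↔ j = i) then (1 : ℝ) else 0) else 1 with hf
  have h : ∀ a : Fin M → Fin n, (if ∀ j ∈ S, a j = v ↔ j = i then (1 : ℝ) else 0)
      = ∏ j, f j (a j) := by
    intro a
    rw [hf, Finset.prod_ite_mem, Finset.univ_inter, Finset.prod_ite_zero]
    simp
  simp only [h]
  rw [expect_prod_apply]
  have h2 : ∀ j, 𝔼 w : Fin n, f j w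
      = if j ∈ S then (if j = i then 1 / (n : ℝ) else 1 - 1 / n) else 1 := by
    intro j
    simp only [hf]
    split_ifs with h1 h2
    · simp only [h2, iff_true]
      exact expect_ite_eq_vertex v
    · simp only [h2, iff_false]
      exact expect_ite_ne_vertex v
    · exact Fintype.expect_const _
  simp only [h2]
  rw [Finset.prod_ite_mem, Finset.univ_inter, ← Finset.mul_prod_erase S _ hi, if_pos rfl]
  congr 1
  rw [Finset.prod_congr rfl fun j hj => if_neg (Finset.ne_of_mem_erase hj), Finset.prod_const,
    Finset.card_erase_of_mem hi]

lemma mem_lone_moved_of_mem {p : Fin M → Fin n} {S : Finset (Fin M)}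
    (hp : Set.InjOn p (Sᶜ : Finset (Fin M))) {v : Fin n} (hv : v ∈ Sᶜ.image p)
    (a : Fin M → Fin n) : v ∈ lone (moved p S a) ↔ ∀ i ∈ S, a i ≠ v := by
  obtain ⟨k, hk, rfl⟩ := Finset.mem_image.1 hv
  have hkS : k ∉ S := Finset.mem_compl.1 hk
  rw [mem_lone]
  constructor
  · rintro ⟨i, hi⟩ j hj hjk
    have h1 : k = i := (hi k).1 (by simp [moved, hkS])
    have h2 : j = i := (hi j).1 (by simp [moved, hj, hjk])
    exact hkS (h1 ▸ h2 ▸ hj)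
  · intro h
    refine ⟨k, fun j => ⟨fun hj => ?_, fun hj => by simp [moved, hj, hkS]⟩⟩
    by_cases hjS : j ∈ S
    · simp only [moved, if_pos hjS] at hj
      exact absurd hj (h j hjS)
    · simp only [moved, if_neg hjS] at hj
      exact hp (by simpa using hjS) (by simpa using hkS) hj

/-- Without a happy occupant, a vertex becomes lone when exactly one mover arrives; the events for
different movers are disjoint, so their indicators add. -/
lemma ite_mem_lone_moved_of_notMem {p : Fin M → Fin n} {S : Finset (Fin M)} {v : Fin n}
    (hv : v ∉ Sᶜ.image p) (a : Fin M → Fin n) :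
    (if v ∈ lone (moved p S a) then (1 : ℝ) else 0)
      = ∑ i ∈ S, if ∀ j ∈ S, a j = v ↔ j = i then (1 : ℝ) else 0 := by
  have hv' : ∀ j, j ∉ S → p j ≠ v := by
    intro j hj h
    exact hv (Finset.mem_image.2 ⟨j, Finset.mem_compl.2 hj, h⟩)
  by_cases h : v ∈ lone (moved p S a)
  · rw [if_pos h]
    obtain ⟨i, hi⟩ := mem_lone.1 h
    have hiS : i ∈ S := by
      by_contra hiS
      have := (hi i).2 rfl
      simp only [moved, if_neg hiS] at this
      exact hv' i hiS this
    have hi' : ∀ j ∈ S, a j = v ↔ j = i := fun j hj => by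
      have := hi j
      simpa only [moved, if_pos hj] using this
    rw [Finset.sum_eq_single_of_mem i hiS, if_pos hi']
    intro k hk hki
    rw [if_neg]
    intro hk'
    exact hki ((hi' k hk).1 ((hk' k hk).2 rfl))
  · rw [if_neg h, Finset.sum_eq_zero]
    intro i hi
    rw [if_neg]
    intro hi'
    refine h (mem_lone.2 ⟨i, fun j => ?_⟩)
    by_cases hj : j ∈ S
    · simpa only [moved, if_pos hj] using hi' j hj
    · simp only [moved, if_neg hj]
      exact ⟨fun h => absurd h (hv' j hj), fun h => absurd (h ▸ hi) hj⟩

/-- The mean number of unhappy particles after one step from `u` unhappy ones. -/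
noncomputable def stepMean (n M u : ℕ) : ℝ :=
  M - (((M : ℝ) - u) * (1 - 1 / n) ^ u
    + ((n : ℝ) - (M - u)) * (u * (1 / n * (1 - 1 / n) ^ (u - 1))))

lemma expect_card_collided_moved [Nonempty (Fin n)] (p : Fin M → Fin n) (S : Finset (Fin M))
    (hp : Set.InjOn p (Sᶜ : Finset (Fin M))) :
    𝔼 a, ((collided (moved p S a)).card : ℝ) = stepMean n M S.card := by
  have h1 : ∀ a, ((collided (moved p S a)).card : ℝ)
      = M - ∑ v, if v ∈ lone (moved p S a) then (1 : ℝ) else 0 := by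
    intro a
    have := card_collided (moved p S a)
    rw [Finset.sum_ite_mem, Finset.univ_inter, Finset.sum_const, nsmul_eq_mul, mul_one,
      eq_sub_iff_add_eq]
    exact_mod_cast this
  simp only [h1]
  rw [Finset.expect_sub_distrib, Fintype.expect_const, Finset.expect_sum_comm]
  have h2 : ∀ v, 𝔼 a : Fin M → Fin n, (if v ∈ lone (moved p S a) then (1 : ℝ) else 0)
      = if v ∈ Sᶜ.image p then (1 - 1 / (n : ℝ)) ^ S.card
        else S.card * (1 / n * (1 - 1 / n) ^ (S.card - 1)) := by
    intro v
    split_ifs with hv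
    · simp only [mem_lone_moved_of_mem hp hv]
      exact expect_avoid S v
    · simp only [ite_mem_lone_moved_of_notMem hv]
      rw [Finset.expect_sum_comm, Finset.sum_congr rfl fun i hi => expect_only S v hi,
        Finset.sum_const, nsmul_eq_mul]
  have h3 : ((Sᶜ.image p).card : ℝ) = M - S.card := by
    rw [Finset.card_image_of_injOn hp, Finset.card_compl, Fintype.card_fin,
      Nat.cast_sub (by simpa using Finset.card_le_univ S)]
  have h4 : (((Sᶜ.image p)ᶜ).card : ℝ) = n - (M - S.card) := by
    rw [Finset.card_compl, Fintype.card_fin,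
      Nat.cast_sub (by simpa using Finset.card_le_univ (Sᶜ.image p)), h3]
  rw [Finset.sum_congr rfl fun v _ => h2 v, Finset.sum_ite, Finset.sum_const, Finset.sum_const,
    nsmul_eq_mul, nsmul_eq_mul, Finset.filter_mem_eq_inter, Finset.univ_inter, h3]
  have h5 : (Finset.univ.filter fun v => v ∉ Sᶜ.image p) = (Sᶜ.image p)ᶜ := by
    ext v
    simp
  rw [h5, h4]
  rfl

lemma expect_sq_card_collided_moved_le [Nonempty (Fin n)] (p : Fin M → Fin n)
    (S : Finset (Fin M)) (hp : Set.InjOn p (Sᶜ : Finset (Fin M))) :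
    𝔼 a, (((collided (moved p S a)).card : ℝ) - stepMean n M S.card) ^ 2 ≤ 8 * S.card := by
  refine expect_sq_le_of_expect_exp_le _ (Nat.cast_nonneg _) fun l => ?_
  rw [← expect_card_collided_moved p S hp]
  exact expect_exp_card_collided_moved_le p S l

lemma expect_tail_card_collided_moved_le [Nonempty (Fin n)] (p : Fin M → Fin n)
    (S : Finset (Fin M)) (hp : Set.InjOn p (Sᶜ : Finset (Fin M))) (hS : 0 < S.card) {s : ℝ}
    (hs : 0 ≤ s) :
    𝔼 a, (if s ≤ |((collided (moved p S a)).card : ℝ) - stepMean n M S.card| then (1 : ℝ) else 0)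
      ≤ 2 * Real.exp (-(s ^ 2 / (8 * S.card))) := by
  refine expect_tail_le_of_expect_exp_le _ (by exact_mod_cast hS) hs fun l => ?_
  rw [← expect_card_collided_moved p S hp]
  exact expect_exp_card_collided_moved_le p S l

/-! ### Comparison of the one-step mean with the drift -/

lemma abs_pow_sub_pow_le {a b : ℝ} (ha : 0 ≤ a) (ha1 : a ≤ 1) (hb : 0 ≤ b) (hb1 : b ≤ 1) (u : ℕ) :
    |a ^ u - b ^ u| ≤ u * |a - b| := by
  induction u with
  | zero => simp
  | succ u ih =>
    have h1 : a ^ (u + 1) - b ^ (u + 1) = a * (a ^ u - b ^ u) + (a - b) * b ^ u := by ring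
    rw [h1]
    refine (abs_add_le _ _).trans ?_
    rw [abs_mul, abs_mul, abs_of_nonneg ha, abs_of_nonneg (pow_nonneg hb u)]
    have h2 := mul_le_mul_of_nonneg_right ha1 (abs_nonneg (a ^ u - b ^ u))
    have h3 := mul_le_mul_of_nonneg_left (pow_le_one₀ (n := u) hb hb1) (abs_nonneg (a - b))
    push_cast
    linarith

lemma abs_one_sub_inv_pow_sub_exp_le (hn : 1 ≤ n) (u : ℕ) :
    |(1 - 1 / (n : ℝ)) ^ u - Real.exp (-(u / n))| ≤ u / (n : ℝ) ^ 2 := by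
  have hn0 : (1 : ℝ) ≤ n := by exact_mod_cast hn
  have hi : 1 / (n : ℝ) ≤ 1 := by rw [div_le_one (by linarith)]; exact hn0
  have hi0 : 0 ≤ 1 / (n : ℝ) := by positivity
  have h1 : Real.exp (-(u / n)) = Real.exp (-(1 / n)) ^ u := by
    rw [← Real.exp_nat_mul]
    congr 1
    ring
  have h2 : |(1 - 1 / (n : ℝ)) - Real.exp (-(1 / n))| ≤ (1 / (n : ℝ)) ^ 2 := by
    have h3 := Real.abs_exp_sub_one_sub_id_le (x := -(1 / (n : ℝ)))
      (by rwa [abs_neg, abs_of_nonneg hi0])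
    rw [neg_sq] at h3
    rw [abs_sub_comm]
    convert h3 using 2
    ring
  rw [h1]
  refine (abs_pow_sub_pow_le (by linarith) (by linarith) (Real.exp_pos _).le
    (Real.exp_le_one_iff.2 (by linarith)) u).trans ?_
  calc _ ≤ (u : ℝ) * (1 / (n : ℝ)) ^ 2 := by gcongr
    _ = _ := by ring

/-- The mean after one step is close to the fluid limit. -/
lemma abs_stepMean_div_sub_drift_le {A : ℝ} (hn : 1 ≤ n) (hM : |(M : ℝ) - n / 2| ≤ A * √n)
    (hMn : M ≤ n) {u : ℕ} (hu : u ≤ M) :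
    |stepMean n M u / n - drift (u / n)| ≤ (2 * A + 3) * (u / n) / √n := by
  have hn0 : (1 : ℝ) ≤ n := by exact_mod_cast hn
  have hs1 : 1 ≤ √(n : ℝ) := Real.one_le_sqrt.2 hn0
  have hs2 : √(n : ℝ) ^ 2 = n := Real.sq_sqrt (by linarith)
  have huM : (u : ℝ) ≤ M := by exact_mod_cast hu
  have hMn' : (M : ℝ) ≤ n := by exact_mod_cast hMn
  set s := √(n : ℝ) with hs
  set q := 1 - 1 / (n : ℝ) with hq
  set x := (u : ℝ) / n with hx
  have hxu : (u : ℝ) = x * n := by rw [hx]; field_simp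
  have hx0 : 0 ≤ x := by positivity
  have hx1 : x ≤ 1 := by rw [hx, div_le_one (by linarith)]; linarith
  have hi : 1 / (n : ℝ) ≤ 1 := by rw [div_le_one (by linarith)]; exact hn0
  have hq0 : 0 ≤ q := by rw [hq]; linarith
  have hq1 : q ≤ 1 := by rw [hq]; linarith [show 0 ≤ 1 / (n : ℝ) by positivity]
  set e := Real.exp (-x) with he
  have he0 : 0 < e := Real.exp_pos _
  have he1 : e ≤ 1 := Real.exp_le_one_iff.2 (by linarith)
  have hA : |q ^ u - e| ≤ x / n := by
    refine (abs_one_sub_inv_pow_sub_exp_le hn u).trans_eq ?_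
    rw [hx]
    field_simp
  have hB : u * |q ^ (u - 1) - e| ≤ u * (2 / n) := by
    rcases Nat.eq_zero_or_pos u with h0 | h0
    · simp [h0]
    · gcongr
      have h1 : q ^ (u - 1) - q ^ u = q ^ (u - 1) * (1 / n) := by
        obtain ⟨k, rfl⟩ : ∃ k, u = k + 1 := ⟨u - 1, by omega⟩
        rw [Nat.add_sub_cancel, pow_succ, hq]
        ring
      have h2 : |q ^ (u - 1) - q ^ u| ≤ 1 / n := by
        rw [h1, abs_of_nonneg (by positivity)]
        exact mul_le_of_le_one_left (by positivity) (pow_le_one₀ hq0 hq1)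
      calc _ ≤ |q ^ (u - 1) - q ^ u| + |q ^ u - e| := abs_sub_le _ _ _
        _ ≤ 1 / n + x / n := add_le_add h2 hA
        _ ≤ 1 / n + 1 / n := by gcongr
        _ = _ := by ring
  -- The factor multiplying the density error is O(x); this keeps the bias proportional to the
  -- number of unhappy particles.
  have hC : 0 ≤ 1 - e * (1 - x) ∧ 1 - e * (1 - x) ≤ 2 * x := by
    have := Real.add_one_le_exp (-x)
    constructor
    · nlinarith
    · nlinarith
  -- Exact splitting into the error of the density M/n against 1/2 and the errors of replacing the
  -- two powers by exp(-x).
  have key : stepMean n M u / n - drift x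
      = ((M : ℝ) - n / 2) / n * (1 - e * (1 - x)) - ((M : ℝ) - u) / n * (q ^ u - e)
        - ((n : ℝ) - (M - u)) / n * (1 / n * (u * (q ^ (u - 1) - e))) := by
    simp only [stepMean, drift]
    rw [← hq, ← he, hxu]
    field_simp
    ring
  have hn1 : (1 : ℝ) / n ≤ 1 / s := by
    apply one_div_le_one_div_of_le (by linarith)
    nlinarith
  have t1 : |((M : ℝ) - n / 2) / n * (1 - e * (1 - x))| ≤ 2 * A * x / s := by
    rw [abs_mul, abs_div, abs_of_nonneg hC.1, abs_of_nonneg (show (0 : ℝ) ≤ n by linarith)]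
    calc _ ≤ A * s / n * (2 * x) := by
          gcongr
          · exact hC.1
          · exact div_nonneg ((abs_nonneg _).trans hM) (by linarith)
          · exact hC.2
      _ = _ := by rw [← hs2]; field_simp
  have t2 : |((M : ℝ) - u) / n * (q ^ u - e)| ≤ x / s := by
    rw [abs_mul, abs_of_nonneg (div_nonneg (by linarith) (by linarith))]
    calc _ ≤ 1 * (x / n) := by
          gcongr
          rw [div_le_one (by linarith)]
          linarith [show (0 : ℝ) ≤ u by positivity]
      _ = x * (1 / n) := by ring
      _ ≤ x * (1 / s) := by gcongr
      _ = _ := by ring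
  have t3 : |((n : ℝ) - (M - u)) / n * (1 / n * (u * (q ^ (u - 1) - e)))| ≤ 2 * x / s := by
    rw [abs_mul, abs_mul, abs_mul, abs_of_nonneg (div_nonneg (by linarith) (by linarith)),
      abs_of_nonneg (show 0 ≤ 1 / (n : ℝ) by positivity),
      abs_of_nonneg (show 0 ≤ (u : ℝ) by positivity)]
    calc _ ≤ 1 * (1 / (n : ℝ) * (u * (2 / n))) := by
          gcongr
          rw [div_le_one (by linarith)]
          linarith
      _ = 2 * x * (1 / n) := by rw [hxu]; field_simp
      _ ≤ 2 * x * (1 / s) := by gcongr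
      _ = _ := by ring
  rw [key]
  calc _ ≤ _ := (abs_sub _ _).trans (add_le_add ((abs_sub _ _).trans (add_le_add t1 t2)) t3)
    _ = _ := by ring

end OneStep

/-! ### Averaging out one step -/

section State

variable {n M : ℕ}

lemma state_succ (v₀ : Fin n) (g : Fin M → ℕ → Fin n) (t : ℕ) :
    state v₀ g (t + 1) =
      (moved (state v₀ g t).1 (state v₀ g t).2 (fun i => g i (t + 1)),
        collided (moved (state v₀ g t).1 (state v₀ g t).2 (fun i => g i (t + 1)))) := rfl

lemma numUnhappy_zero (v₀ : Fin n) (g : Fin M → ℕ → Fin n) : numUnhappy v₀ g 0 = M := by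
  simp [numUnhappy, state]

lemma numUnhappy_le (v₀ : Fin n) (g : Fin M → ℕ → Fin n) (t : ℕ) : numUnhappy v₀ g t ≤ M :=
  (Finset.card_le_univ (state v₀ g t).2).trans_eq (Fintype.card_fin M)

lemma injOn_state (v₀ : Fin n) (g : Fin M → ℕ → Fin n) (t : ℕ) :
    Set.InjOn (state v₀ g t).1 ((state v₀ g t).2ᶜ : Finset (Fin M)) := by
  cases t with
  | zero => simp [state]
  | succ t => exact injOn_compl_collided _

/-- A function of the moves that depends only on the moves up to step `t`. -/
def DependsUpTo {γ : Type*} (t : ℕ) (Φ : (Fin M → ℕ → Fin n) → γ) : Prop :=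
  ∀ g g' : Fin M → ℕ → Fin n, (∀ i s, s ≤ t → g i s = g' i s) → Φ g = Φ g'

lemma dependsUpTo_state (v₀ : Fin n) (t : ℕ) :
    DependsUpTo t (fun g : Fin M → ℕ → Fin n => state v₀ g t) := by
  induction t with
  | zero => exact fun _ _ _ => rfl
  | succ t ih =>
    intro g g' h
    have h1 : state v₀ g t = state v₀ g' t := ih g g' fun i s hs => h i s (by omega)
    have h2 : (fun i => g i (t + 1)) = fun i => g' i (t + 1) := funext fun i => h i _ le_rfl
    simp only [state_succ, h1, h2]

lemma DependsUpTo.mono {γ : Type*} {s t : ℕ} (hst : s ≤ t) {Φ : (Fin M → ℕ → Fin n) → γ}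
    (h : DependsUpTo s Φ) : DependsUpTo t Φ :=
  fun g g' hg => h g g' fun i r hr => hg i r (hr.trans hst)

lemma DependsUpTo.comp {γ γ' : Type*} {t : ℕ} {Φ : (Fin M → ℕ → Fin n) → γ}
    (h : DependsUpTo t Φ) (f : γ → γ') : DependsUpTo t (fun g => f (Φ g)) :=
  fun g g' hg => congrArg f (h g g' hg)

lemma dependsUpTo_numUnhappy (v₀ : Fin n) (t : ℕ) :
    DependsUpTo t (fun g : Fin M → ℕ → Fin n => numUnhappy v₀ g t) :=
  (dependsUpTo_state v₀ t).comp fun σ => σ.2.card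

end State

section Integral

variable {Ω : Type*} [MeasurableSpace Ω] {P : Measure Ω} {n M : ℕ}
  {G : Fin M → ℕ → Ω → Fin n}

/-- The moves up to step `t`, extended by the constant vertex `v₀`. -/
def extendMoves (v₀ : Fin n) (t : ℕ)
    (h : ((Finset.univ : Finset (Fin M)) ×ˢ Finset.range (t + 1) : Finset (Fin M × ℕ)) → Fin n) :
    Fin M → ℕ → Fin n :=
  fun i s => if hs : s < t + 1 then h ⟨(i, s), by simpa using hs⟩ else v₀

/-- A function of the moves up to `t` factors through finitely many coordinates with finite range,
so measurability and integrability come for free. The filler vertex plays no role. -/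
lemma DependsUpTo.extendMoves_eq {γ : Type*} {t : ℕ} {Φ : (Fin M → ℕ → Fin n) → γ}
    (h : DependsUpTo t Φ) (v₀ : Fin n) (g : Fin M → ℕ → Fin n) :
    Φ (extendMoves v₀ t fun x => g x.1.1 x.1.2) = Φ g := by
  refine h _ _ fun i s hs => ?_
  rw [extendMoves, dif_pos (by omega)]

lemma IsUniformMoves.map_move_real (hG : IsUniformMoves P G) (t : ℕ) (a : Fin M → Fin n) :
    (P.map fun ω i => G i t ω).real {a} = 1 / (n : ℝ) ^ M := by
  have hA : Measurable fun ω i => G i t ω := measurable_pi_iff.2 fun i => hG.measurable _ _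
  have h1 : iIndepFun (fun i => G i t) P :=
    hG.indep.precomp (g := fun i : Fin M => (i, t)) fun i j h => (Prod.mk.inj h).1
  have h2 := h1.measure_inter_preimage_eq_mul Finset.univ (sets := fun i => {a i})
    fun i _ => measurableSet_singleton _
  rw [map_measureReal_apply hA (measurableSet_singleton _)]
  have h3 : (fun ω i => G i t ω) ⁻¹' {a} = ⋂ i ∈ Finset.univ, G i t ⁻¹' {a i} := by
    ext ω
    simp [funext_iff]
  rw [h3, measureReal_def, h2, ENNReal.toReal_prod]
  have h4 : ∀ i, (P (G i t ⁻¹' {a i})).toReal = 1 / n := fun i => hG.uniform i t (a i)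
  simp [h4]

variable [IsProbabilityMeasure P]

lemma IsUniformMoves.integrable (hG : IsUniformMoves P G) (v₀ : Fin n) {t : ℕ}
    {Φ : (Fin M → ℕ → Fin n) → ℝ} (h : DependsUpTo t Φ) :
    Integrable (fun ω => Φ fun i s => G i s ω) P := by
  have hH : Measurable fun ω (x : ((Finset.univ : Finset (Fin M)) ×ˢ Finset.range (t + 1) :
      Finset (Fin M × ℕ))) => G x.1.1 x.1.2 ω := measurable_pi_iff.2 fun x => hG.measurable _ _
  have h1 := (Integrable.of_finite (f := fun k => Φ (extendMoves v₀ t k))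
    (μ := P.map fun ω (x : ((Finset.univ : Finset (Fin M)) ×ˢ Finset.range (t + 1) :
      Finset (Fin M × ℕ))) => G x.1.1 x.1.2 ω)).comp_measurable hH
  refine h1.congr (Eventually.of_forall fun ω => ?_)
  exact h.extendMoves_eq v₀ fun i s => G i s ω

/-- The moves of step `t + 1` may be averaged out given the moves up to step `t`. -/
theorem IsUniformMoves.integral_step (hG : IsUniformMoves P G) (v₀ : Fin n) {t : ℕ}
    (Φ : (Fin M → ℕ → Fin n) → (Fin M → Fin n) → ℝ) (h : DependsUpTo t Φ) :
    ∫ ω, Φ (fun i s => G i s ω) (fun i => G i (t + 1) ω) ∂P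
      = ∫ ω, 𝔼 a, Φ (fun i s => G i s ω) a ∂P := by
  set S : Finset (Fin M × ℕ) := Finset.univ ×ˢ Finset.range (t + 1) with hS
  set S' : Finset (Fin M × ℕ) := Finset.univ ×ˢ {t + 1} with hS'
  set H : Ω → S → Fin n := fun ω x => G x.1.1 x.1.2 ω with hHdef
  set A : Ω → Fin M → Fin n := fun ω i => G i (t + 1) ω with hAdef
  have hH : Measurable H := measurable_pi_iff.2 fun x => hG.measurable _ _
  have hA : Measurable A := measurable_pi_iff.2 fun i => hG.measurable _ _
  have hdisj : Disjoint S S' := by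
    rw [Finset.disjoint_left]
    rintro ⟨i, s⟩ h1 h2
    simp only [hS, hS', Finset.mem_product, Finset.mem_univ, true_and, Finset.mem_range,
      Finset.mem_singleton] at h1 h2
    omega
  -- Past and new moves are indexed by disjoint finite blocks of one independent family.
  have hind : IndepFun H A P := by
    have h1 := hG.indep.indepFun_finset S S' hdisj fun x => hG.measurable _ _
    exact h1.comp (φ := id) (ψ := fun (k : S' → Fin n) (i : Fin M) => k ⟨(i, t + 1), by simp [hS']⟩)
      measurable_id (measurable_pi_iff.2 fun i => measurable_pi_apply _)
  have hmap := (indepFun_iff_map_prod_eq_prod_map_map hH.aemeasurable hA.aemeasurable).1 hind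
  have := Measure.isProbabilityMeasure_map (μ := P) hH.aemeasurable
  have := Measure.isProbabilityMeasure_map (μ := P) hA.aemeasurable
  set Ψ : (S → Fin n) → (Fin M → Fin n) → ℝ := fun k a => Φ (extendMoves v₀ t k) a with hΨ
  have hΦ : ∀ ω a, Φ (fun i s => G i s ω) a = Ψ (H ω) a := fun ω a =>
    (congrFun (h.extendMoves_eq v₀ fun i s => G i s ω) a).symm
  have hinner : ∀ k, ∫ a, Ψ k a ∂(P.map A) = 𝔼 a, Ψ k a := by
    intro k
    rw [integral_fintype Integrable.of_finite, Fintype.expect_eq_sum_div_card,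
      Finset.sum_div]
    refine Finset.sum_congr rfl fun a _ => ?_
    rw [hAdef, hG.map_move_real]
    simp
    ring
  calc _ = ∫ ω, (fun z : (S → Fin n) × (Fin M → Fin n) => Ψ z.1 z.2) (H ω, A ω) ∂P := by
        simp only [hΦ]
        rfl
    _ = ∫ z, Ψ z.1 z.2 ∂(P.map fun ω => (H ω, A ω)) := by
        rw [integral_map (hH.prodMk hA).aemeasurable]
        exact (measurable_of_finite _).aestronglyMeasurable
    _ = ∫ k, ∫ a, Ψ k a ∂(P.map A) ∂(P.map H) := by
        rw [hmap, integral_prod _ Integrable.of_finite]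
    _ = ∫ k, 𝔼 a, Ψ k a ∂(P.map H) := by simp only [hinner]
    _ = ∫ ω, 𝔼 a, Ψ (H ω) a ∂P := by
        rw [integral_map hH.aemeasurable]
        exact (measurable_of_finite _).aestronglyMeasurable
    _ = _ := by simp only [hΦ]

end Integral

/-! ### Deviation from the fluid limit -/

/-- The relative deviation of `u` unhappy particles at step `t` from the fluid limit. -/
noncomputable def relDev (n t u : ℕ) : ℝ := (u / n - fluid t) / fluid t

/-- The constant in the one-step growth of the squared relative deviation. -/
noncomputable def growth (A : ℝ) : ℝ := 900 + 2 * (3 * (2 * A + 3)) + 3 * (3 * (2 * A + 3)) ^ 2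

lemma growth_nonneg {A : ℝ} (hA : 0 ≤ A) : 0 ≤ growth A := by
  unfold growth
  positivity

/-- Here s stands for 1/√n and N for the number of steps. Cross terms are split by the
arithmetic–geometric mean inequality into d²/N, which compounds to a bounded factor over N steps,
and Ns², which adds up to N²/n. The number 900 leaves room above 576 and 288 + 1. -/
lemma sq_add_growth_le {d s N B : ℝ} (hs : 0 ≤ s) (hN : 1 ≤ N) (hNs : N * s ≤ 1)
    (hB : 0 ≤ B) :
    (d + B * (1 + d) * s) ^ 2 + 288 * N * (1 + d) * s ^ 2
      ≤ (1 + (900 + 2 * B + 3 * B ^ 2) / N) * d ^ 2 + (900 + 2 * B + 3 * B ^ 2) * N * s ^ 2 := by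
  have hN0 : 0 < N := by linarith
  have hsN : s ≤ 1 / N := by rw [le_div_iff₀ hN0]; linarith
  have hs2 : s ^ 2 ≤ 1 / N := by
    have h1 : s ≤ 1 := hsN.trans (by rw [div_le_one hN0]; exact hN)
    nlinarith
  have hNs2 : N * s ^ 2 ≤ 1 / N := by
    have : N * s ^ 2 = (N * s) * s := by ring
    rw [this]
    nlinarith
  have hd1 : (1 + d) ^ 2 ≤ 2 + 2 * d ^ 2 := by nlinarith [sq_nonneg (1 - d)]
  have hd2 : 1 + d ≤ 2 + d ^ 2 := by nlinarith [sq_nonneg (1 - d)]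
  have a1 : 2 * B * d * s ≤ 1 / N * d ^ 2 + B ^ 2 * (N * s ^ 2) := by
    have h : 0 ≤ 1 / N * (d - N * (B * s)) ^ 2 := by positivity
    have h2 : 1 / N * (d - N * (B * s)) ^ 2
        = 1 / N * d ^ 2 + B ^ 2 * (N * s ^ 2) - 2 * B * d * s := by
      field_simp
      ring
    linarith
  have a2 : 2 * B * d ^ 2 * s ≤ 2 * B * d ^ 2 * (1 / N) := by gcongr
  have a3 : B ^ 2 * (1 + d) ^ 2 * s ^ 2 ≤ 2 * B ^ 2 * (N * s ^ 2) + 2 * B ^ 2 * d ^ 2 * (1 / N) := by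
    have h1 : B ^ 2 * (1 + d) ^ 2 * s ^ 2 ≤ B ^ 2 * (2 + 2 * d ^ 2) * s ^ 2 := by gcongr
    have h2 : B ^ 2 * d ^ 2 * s ^ 2 ≤ B ^ 2 * d ^ 2 * (1 / N) := by gcongr
    have h3 : B ^ 2 * s ^ 2 ≤ B ^ 2 * (N * s ^ 2) := by
      have : s ^ 2 ≤ N * s ^ 2 := le_mul_of_one_le_left (by positivity) hN
      gcongr
    linarith
  have a4 : 288 * N * (1 + d) * s ^ 2 ≤ 576 * (N * s ^ 2) + 288 * d ^ 2 * (1 / N) := by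
    have h1 : 288 * N * (1 + d) * s ^ 2 ≤ 288 * N * (2 + d ^ 2) * s ^ 2 := by gcongr
    have h2 : d ^ 2 * (N * s ^ 2) ≤ d ^ 2 * (1 / N) := by gcongr
    linarith
  have e1 : (d + B * (1 + d) * s) ^ 2
      = d ^ 2 + 2 * B * d * s + 2 * B * d ^ 2 * s + B ^ 2 * (1 + d) ^ 2 * s ^ 2 := by ring
  have e2 : (1 + (900 + 2 * B + 3 * B ^ 2) / N) * d ^ 2 + (900 + 2 * B + 3 * B ^ 2) * N * s ^ 2
      = d ^ 2 + (900 + 2 * B + 3 * B ^ 2) * (d ^ 2 * (1 / N))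
        + (900 + 2 * B + 3 * B ^ 2) * (N * s ^ 2) := by ring
  have p1 : 0 ≤ d ^ 2 * (1 / N) := by positivity
  have p2 : 0 ≤ N * s ^ 2 := by positivity
  have p3 : 0 ≤ B ^ 2 * (d ^ 2 * (1 / N)) := by positivity
  have p4 : 0 ≤ B * (N * s ^ 2) := by positivity
  rw [e1, e2]
  linarith

section Deviation

variable {n M : ℕ}

/-- One-step growth of the squared relative deviation. -/
lemma expect_relDev_sq_le [Nonempty (Fin n)] {A : ℝ} (hA : 0 ≤ A) (hn : 1 ≤ n)
    (hM : |(M : ℝ) - n / 2| ≤ A * √n) (hMn : (M : ℝ) ≤ 3 / 5 * n) (p : Fin M → Fin n)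
    (S : Finset (Fin M)) (hp : Set.InjOn p (Sᶜ : Finset (Fin M))) {t N : ℕ} (htN : t < N)
    (hN : (N : ℝ) ≤ √n) :
    𝔼 a, relDev n (t + 1) (collided (moved p S a)).card ^ 2
      ≤ (1 + growth A / N) * relDev n t S.card ^ 2 + growth A * N / n := by
  have hn0 : (1 : ℝ) ≤ n := by exact_mod_cast hn
  have hs1 : 1 ≤ √(n : ℝ) := Real.one_le_sqrt.2 hn0
  have hs2 : √(n : ℝ) ^ 2 = n := Real.sq_sqrt (by linarith)
  have hN1 : (1 : ℝ) ≤ N := by exact_mod_cast (by omega : 1 ≤ N)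
  have htN' : (t : ℝ) + 1 ≤ N := by exact_mod_cast htN
  have hSM : S.card ≤ M := by simpa using Finset.card_le_univ S
  have hSM' : (S.card : ℝ) ≤ M := by exact_mod_cast hSM
  have hMn2 : M ≤ n := by
    have : (M : ℝ) ≤ n := by linarith
    exact_mod_cast this
  set x := fluid t with hx
  set y := fluid (t + 1) with hy
  set X : ℝ := S.card / n with hX
  have hx0 : 0 < x := fluid_pos t
  have hy0 : 0 < y := fluid_pos (t + 1)
  have hX0 : 0 ≤ X := by positivity
  have hX1 : X ≤ 3 / 5 := by rw [hX, div_le_iff₀ (by linarith)]; linarith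
  have hxy : x ≤ 3 * y := fluid_le_three_mul_succ t
  set d := |relDev n t S.card| with hd
  have hdx : |X - x| = d * x := by
    rw [hd, relDev, abs_div, abs_of_pos hx0, div_mul_cancel₀ _ hx0.ne']
  have hXd : X ≤ (1 + d) * x := by
    have := le_abs_self (X - x)
    linarith
  set s := 1 / √(n : ℝ) with hs
  have hs0 : 0 ≤ s := by positivity
  have hsn : s ^ 2 = 1 / n := by rw [hs, div_pow, hs2, one_pow]
  set B := 3 * (2 * A + 3) with hB
  have hd0 : 0 ≤ d := abs_nonneg _
  have hB0 : 0 ≤ B := by positivity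
  -- The chord estimate gives d the coefficient 1, so the drift itself causes no growth.
  have hbias : |stepMean n M S.card / n - y| ≤ (d + B * (1 + d) * s) * y := by
    have h1 := abs_stepMean_div_sub_drift_le hn hM hMn2 hSM
    have h2 := abs_drift_sub_drift_mul_le hx0.le (fluid_le_half t) hX0 hX1
    have h3 : drift x = y := rfl
    rw [h3, hdx] at h2
    have h4 : |drift X - y| ≤ d * y := by
      have : |drift X - y| * x ≤ (d * y) * x := by linarith
      exact le_of_mul_le_mul_right this hx0
    have h5 : (2 * A + 3) * X / √(n : ℝ) ≤ B * (1 + d) * s * y := by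
      calc (2 * A + 3) * X / √(n : ℝ) = (2 * A + 3) * X * s := by rw [hs]; ring
        _ ≤ (2 * A + 3) * ((1 + d) * (3 * y)) * s := by
            gcongr
            exact hXd.trans (by gcongr)
        _ = _ := by rw [hB]; ring
    calc _ ≤ |stepMean n M S.card / n - drift X| + |drift X - y| := abs_sub_le _ _ _
      _ ≤ _ := by linarith
  -- Since t + 1 ≤ N, 1/y ≤ 6(t + 2) ≤ 12N; and 288 = 8 · 3 · 12.
  have hvar : 8 * (S.card : ℝ) / n ^ 2 ≤ 288 * N * (1 + d) * s ^ 2 * y ^ 2 := by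
    have h1 : y⁻¹ ≤ 12 * N := by
      refine (inv_fluid_le (t + 1)).trans ?_
      push_cast
      linarith
    have h2 : 1 ≤ 12 * N * y := by
      rwa [inv_le_iff_one_le_mul₀ hy0] at h1
    calc 8 * (S.card : ℝ) / n ^ 2 = 8 * X * s ^ 2 := by rw [hsn, hX]; field_simp
      _ ≤ 8 * ((1 + d) * (3 * y)) * s ^ 2 := by
          gcongr
          exact hXd.trans (by gcongr)
      _ = 24 * (1 + d) * s ^ 2 * y * 1 := by ring
      _ ≤ 24 * (1 + d) * s ^ 2 * y * (12 * N * y) := by gcongr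
      _ = _ := by ring
  have hsplit : ∀ a, relDev n (t + 1) (collided (moved p S a)).card ^ 2
      = (((collided (moved p S a)).card : ℝ) - n * y) ^ 2 / (n * y) ^ 2 := by
    intro a
    rw [relDev, ← hy, ← div_pow]
    congr 1
    field_simp
  simp only [hsplit]
  rw [← Finset.expect_div, expect_sub_sq, expect_card_collided_moved p S hp, add_div]
  have hv := expect_sq_card_collided_moved_le p S hp
  have t1 : (𝔼 a, (((collided (moved p S a)).card : ℝ) - stepMean n M S.card) ^ 2) / (n * y) ^ 2
      ≤ 288 * N * (1 + d) * s ^ 2 := by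
    rw [div_le_iff₀ (by positivity)]
    calc _ ≤ 8 * (S.card : ℝ) := hv
      _ = 8 * (S.card : ℝ) / n ^ 2 * n ^ 2 := by field_simp
      _ ≤ 288 * N * (1 + d) * s ^ 2 * y ^ 2 * n ^ 2 := by gcongr
      _ = _ := by ring
  have t2 : (stepMean n M S.card - n * y) ^ 2 / (n * y) ^ 2 ≤ (d + B * (1 + d) * s) ^ 2 := by
    rw [← div_pow]
    have : (stepMean n M S.card - n * y) / (n * y) = (stepMean n M S.card / n - y) / y := by
      field_simp
    rw [this]
    refine sq_le_sq' ?_ ?_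
    · rw [le_div_iff₀ hy0]
      linarith [neg_abs_le (stepMean n M S.card / n - y)]
    · rw [div_le_iff₀ hy0]
      exact (le_abs_self _).trans hbias
  have hfin := sq_add_growth_le (d := d) hs0 hN1 (by rw [hs, mul_one_div, div_le_one (by linarith)]; exact hN)
    hB0
  have hg : growth A = 900 + 2 * B + 3 * B ^ 2 := rfl
  rw [← hg, hd, sq_abs, ← hd, hsn] at hfin
  rw [hsn] at t1
  calc _ ≤ _ := add_le_add t1 t2
    _ ≤ _ := by
      rw [add_comm]
      refine hfin.trans_eq ?_
      ring

/-- A discrete Grönwall inequality. -/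
lemma le_of_succ_le_mul_add {e : ℕ → ℝ} {q c : ℝ} (hq : 0 ≤ q) (hc : 0 ≤ c) {N : ℕ}
    (h : ∀ t < N, e (t + 1) ≤ (1 + q) * e t + c) : e N ≤ (1 + q) ^ N * (e 0 + c * N) := by
  have key : ∀ t ≤ N, e t ≤ (1 + q) ^ t * (e 0 + c * t) := by
    intro t
    induction t with
    | zero => simp
    | succ t ih =>
      intro ht
      have h1 := h t (by omega)
      have h2 := ih (by omega)
      have h3 : 1 ≤ (1 + q) ^ (t + 1) := one_le_pow₀ (by linarith)
      calc _ ≤ (1 + q) * ((1 + q) ^ t * (e 0 + c * t)) + c * 1 :=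
            h1.trans (by rw [mul_one]; gcongr)
        _ ≤ (1 + q) * ((1 + q) ^ t * (e 0 + c * t)) + c * (1 + q) ^ (t + 1) := by gcongr
        _ = _ := by push_cast; ring
  exact key N le_rfl

/-- The constant in the bounds for the squared relative deviation. -/
noncomputable def devConst (A : ℝ) : ℝ := Real.exp (growth A) * (4 * A ^ 2 + growth A)

lemma devConst_nonneg {A : ℝ} (hA : 0 ≤ A) : 0 ≤ devConst A := by
  have := growth_nonneg hA
  unfold devConst
  positivity

lemma relDev_zero_sq_le {A : ℝ} (hn : 1 ≤ n) (hM : |(M : ℝ) - n / 2| ≤ A * √n) :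
    relDev n 0 M ^ 2 ≤ 4 * A ^ 2 / n := by
  have hn0 : (1 : ℝ) ≤ n := by exact_mod_cast hn
  have hs2 : √(n : ℝ) ^ 2 = n := Real.sq_sqrt (by linarith)
  have h1 : relDev n 0 M ^ 2 = 4 * ((M : ℝ) - n / 2) ^ 2 / n ^ 2 := by
    simp only [relDev, fluid]
    field_simp
    ring
  have h2 : ((M : ℝ) - n / 2) ^ 2 ≤ A ^ 2 * n := by
    rw [← sq_abs]
    calc _ ≤ (A * √n) ^ 2 := by gcongr
      _ = _ := by rw [mul_pow, hs2]
  rw [h1]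
  calc _ ≤ 4 * (A ^ 2 * n) / (n : ℝ) ^ 2 := by gcongr
    _ = _ := by field_simp

/-- Because (1 + g/N)^N ≤ exp g, the constant does not depend on N. The plain and the stopped second
moments both satisfy this recursion. -/
lemma le_devConst_of_succ_le {A : ℝ} (hA : 0 ≤ A) (hn : 1 ≤ n) {e : ℕ → ℝ} {N : ℕ} (hN : 1 ≤ N)
    (h0 : e 0 ≤ 4 * A ^ 2 / n)
    (h : ∀ t < N, e (t + 1) ≤ (1 + growth A / N) * e t + growth A * N / n) :
    e N ≤ devConst A * N ^ 2 / n := by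
  have hn0 : (1 : ℝ) ≤ n := by exact_mod_cast hn
  have hN1 : (1 : ℝ) ≤ N := by exact_mod_cast hN
  have hg := growth_nonneg hA
  refine (le_of_succ_le_mul_add (by positivity) (by positivity) h).trans ?_
  have h1 : (1 + growth A / N) ^ N ≤ Real.exp (growth A) := by
    have := Real.add_one_le_exp (growth A / N)
    calc _ ≤ Real.exp (growth A / N) ^ N := by
          gcongr
          linarith
      _ = _ := by
          rw [← Real.exp_nat_mul]
          congr 1
          field_simp
  have h2 : e 0 + growth A * N / n * N ≤ (4 * A ^ 2 + growth A) * N ^ 2 / n := by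
    have : 4 * A ^ 2 / n * 1 ≤ 4 * A ^ 2 / n * (N : ℝ) ^ 2 := by
      gcongr
      exact one_le_pow₀ hN1
    calc _ ≤ 4 * A ^ 2 / n * (N : ℝ) ^ 2 + growth A * N / n * N := by linarith
      _ = _ := by ring
  calc _ ≤ (1 + growth A / N) ^ N * ((4 * A ^ 2 + growth A) * N ^ 2 / n) := by gcongr
    _ ≤ Real.exp (growth A) * ((4 * A ^ 2 + growth A) * N ^ 2 / n) := by gcongr
    _ = _ := by rw [devConst]; ring

section Moments

variable {Ω : Type*} [MeasurableSpace Ω] {P : Measure Ω} [IsProbabilityMeasure P]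
  {G : Fin M → ℕ → Ω → Fin n} {A : ℝ}

lemma dependsUpTo_relDev_sq (v₀ : Fin n) (t : ℕ) : DependsUpTo t
    (fun g : Fin M → ℕ → Fin n => relDev n t (numUnhappy v₀ g t) ^ 2) :=
  (dependsUpTo_numUnhappy v₀ t).comp fun u => relDev n t u ^ 2

lemma dependsUpTo_moved (v₀ : Fin n) (t : ℕ) : DependsUpTo t
    (fun (g : Fin M → ℕ → Fin n) a => moved (state v₀ g t).1 (state v₀ g t).2 a) :=
  (dependsUpTo_state v₀ t).comp fun σ a => moved σ.1 σ.2 a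

lemma DependsUpTo.expect {t : ℕ} {Φ : (Fin M → ℕ → Fin n) → (Fin M → Fin n) → ℝ}
    (h : DependsUpTo t Φ) : DependsUpTo t fun g => 𝔼 a, Φ g a :=
  h.comp fun f => 𝔼 a, f a

/-- Second moment bound for the relative deviation from the fluid limit. -/
theorem integral_relDev_sq_le (hG : IsUniformMoves P G) (v₀ : Fin n) (hA : 0 ≤ A) (hn : 1 ≤ n)
    (hM : |(M : ℝ) - n / 2| ≤ A * √n) (hMn : (M : ℝ) ≤ 3 / 5 * n) {N : ℕ} (hN1 : 1 ≤ N)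
    (hN : (N : ℝ) ≤ √n) :
    ∫ ω, relDev n N (numUnhappy v₀ (fun i t => G i t ω) N) ^ 2 ∂P ≤ devConst A * N ^ 2 / n := by
  have : Nonempty (Fin n) := ⟨v₀⟩
  refine le_devConst_of_succ_le
    (e := fun t => ∫ ω, relDev n t (numUnhappy v₀ (fun i t => G i t ω) t) ^ 2 ∂P) hA hn hN1 ?_ ?_
  · simp only [numUnhappy_zero, integral_const, probReal_univ, one_smul]
    exact relDev_zero_sq_le hn hM
  · intro t ht
    have hdep : DependsUpTo t (fun (g : Fin M → ℕ → Fin n) a =>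
        relDev n (t + 1) (collided (moved (state v₀ g t).1 (state v₀ g t).2 a)).card ^ 2) :=
      (dependsUpTo_moved v₀ t).comp fun f a => relDev n (t + 1) (collided (f a)).card ^ 2
    have h1 := hG.integral_step v₀ _ hdep
    have hint := hG.integrable v₀ (dependsUpTo_relDev_sq v₀ t)
    calc _ = _ := h1
      _ ≤ ∫ ω, ((1 + growth A / N) * relDev n t (numUnhappy v₀ (fun i t => G i t ω) t) ^ 2
            + growth A * N / n) ∂P := by
          refine integral_mono (hG.integrable v₀ hdep.expect)
            ((hint.const_mul _).add (integrable_const _)) fun ω => ?_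
          exact expect_relDev_sq_le hA hn hM hMn _ _ (injOn_state v₀ _ t) ht hN
      _ = _ := by
          rw [integral_add (hint.const_mul _) (integrable_const _), integral_const_mul]
          simp

open Classical in
/-- Maximal inequality for the relative deviation from the fluid limit. -/
theorem measureReal_exists_relDev_sq_le (hG : IsUniformMoves P G) (v₀ : Fin n) (hA : 0 ≤ A)
    (hn : 1 ≤ n) (hM : |(M : ℝ) - n / 2| ≤ A * √n) (hMn : (M : ℝ) ≤ 3 / 5 * n) {N : ℕ}
    (hN1 : 1 ≤ N) (hN : (N : ℝ) ≤ √n) {l : ℝ} (hl : 0 < l) :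
    P.real {ω | ∃ t ≤ N, l ≤ relDev n t (numUnhappy v₀ (fun i t => G i t ω) t) ^ 2}
      ≤ devConst A * N ^ 2 / n / l := by
  have : Nonempty (Fin n) := ⟨v₀⟩
  set d : ℕ → (Fin M → ℕ → Fin n) → ℝ := fun t g => relDev n t (numUnhappy v₀ g t) ^ 2 with hd
  have hd0 : ∀ t g, 0 ≤ d t g := fun t g => sq_nonneg _
  -- The squared deviation, frozen at the value `l` from the first time it reaches that level.
  -- Markov's inequality for `W N` then covers all times up to `N`.
  set W : ℕ → (Fin M → ℕ → Fin n) → ℝ := fun t g => if ∀ s ≤ t, d s g < l then d t g else l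
    with hW
  have hgate : ∀ t, DependsUpTo t fun g : Fin M → ℕ → Fin n => ∀ s ≤ t, d s g < l := by
    intro t g g' hg
    refine propext (forall₂_congr fun s hs => ?_)
    rw [show d s g = d s g' from (dependsUpTo_relDev_sq v₀ s).mono hs g g' hg]
  have hWdep : ∀ t, DependsUpTo t (W t) := by
    intro t g g' hg
    have h1 := hgate t g g' hg
    have h2 : d t g = d t g' := dependsUpTo_relDev_sq v₀ t g g' hg
    simp only at h1
    simp only [hW, h1, h2]
  have hg := growth_nonneg hA
  have hmain : ∫ ω, W N (fun i t => G i t ω) ∂P ≤ devConst A * N ^ 2 / n := by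
    refine le_devConst_of_succ_le
      (e := fun t => ∫ ω, W t (fun i t => G i t ω) ∂P) hA hn hN1 ?_ ?_
    · have hle : ∀ g, W 0 g ≤ 4 * A ^ 2 / n := by
        intro g
        have h0 : d 0 g ≤ 4 * A ^ 2 / n := by
          simp only [hd, numUnhappy_zero]
          exact relDev_zero_sq_le hn hM
        simp only [hW]
        split_ifs with h
        · exact h0
        · push Not at h
          obtain ⟨s, hs, hls⟩ := h
          obtain rfl : s = 0 := by omega
          exact hls.trans h0
      calc _ ≤ ∫ _, 4 * A ^ 2 / (n : ℝ) ∂P :=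
            integral_mono (hG.integrable v₀ (hWdep 0)) (integrable_const _) fun ω => hle _
        _ = _ := by simp
    · intro t ht
      set Φ : (Fin M → ℕ → Fin n) → (Fin M → Fin n) → ℝ := fun g a =>
        if ∀ s ≤ t, d s g < l then
          relDev n (t + 1) (collided (moved (state v₀ g t).1 (state v₀ g t).2 a)).card ^ 2
        else l with hΦ
      have hdep : DependsUpTo t Φ := by
        intro g g' hg
        have h1 := hgate t g g' hg
        have h2 : moved (state v₀ g t).1 (state v₀ g t).2
            = moved (state v₀ g' t).1 (state v₀ g' t).2 := dependsUpTo_moved v₀ t g g' hg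
        simp only at h1
        simp only [hΦ, h1, h2]
      have hstep := hG.integral_step v₀ _ hdep
      -- If the level is first reached at t + 1, freezing replaces a value that is at least `l` by
      -- `l`, so it can only decrease.
      have hle : ∀ g, W (t + 1) g ≤ Φ g fun i => g i (t + 1) := by
        intro g
        have hnext : relDev n (t + 1) (collided (moved (state v₀ g t).1 (state v₀ g t).2
            fun i => g i (t + 1))).card ^ 2 = d (t + 1) g := rfl
        simp only [hW, hΦ, hnext]
        split_ifs with h1 h2 h2
        · exact le_rfl
        · exact absurd (fun s hs => h1 s (by omega)) h2
        · push Not at h1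
          obtain ⟨s, hs, hls⟩ := h1
          rcases Nat.lt_or_ge s (t + 1) with h3 | h3
          · exact absurd hls (not_le.2 (h2 s (by omega)))
          · obtain rfl : s = t + 1 := by omega
            exact hls
        · exact le_rfl
      have hexp : ∀ g, 𝔼 a, Φ g a ≤ (1 + growth A / N) * W t g + growth A * N / n := by
        intro g
        by_cases h : ∀ s ≤ t, d s g < l
        · simp only [hΦ, hW, if_pos h]
          exact expect_relDev_sq_le hA hn hM hMn _ _ (injOn_state v₀ _ t) ht hN
        · simp only [hΦ, hW, if_neg h, Fintype.expect_const]
          have : 0 ≤ growth A / N * l := by positivity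
          have : 0 ≤ growth A * N / n := by positivity
          linarith
      have hint := hG.integrable v₀ (hWdep t)
      have hdep' : DependsUpTo (t + 1) fun g : Fin M → ℕ → Fin n => Φ g fun i => g i (t + 1) := by
        intro g g' hg
        have h1 : Φ g = Φ g' := hdep.mono t.le_succ g g' hg
        have h2 : (fun i => g i (t + 1)) = fun i => g' i (t + 1) :=
          funext fun i => hg i _ le_rfl
        simp only [h1, h2]
      calc _ ≤ ∫ ω, Φ (fun i s => G i s ω) (fun i => G i (t + 1) ω) ∂P :=
            integral_mono (hG.integrable v₀ (hWdep (t + 1))) (hG.integrable v₀ hdep')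
              fun ω => hle _
        _ = _ := hstep
        _ ≤ ∫ ω, ((1 + growth A / N) * W t (fun i s => G i s ω) + growth A * N / n) ∂P :=
            integral_mono (hG.integrable v₀ hdep.expect)
              ((hint.const_mul _).add (integrable_const _)) fun ω => hexp _
        _ = _ := by
          rw [integral_add (hint.const_mul _) (integrable_const _), integral_const_mul]
          simp
  have hW0 : ∀ g, 0 ≤ W N g := by
    intro g
    simp only [hW]
    split_ifs
    · exact hd0 _ _
    · exact hl.le
  have hmarkov := mul_meas_ge_le_integral_of_nonneg
    (Eventually.of_forall fun ω => hW0 fun i t => G i t ω) (hG.integrable v₀ (hWdep N)) l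
  rw [le_div_iff₀ hl, mul_comm]
  refine le_trans ?_ (hmarkov.trans hmain)
  refine mul_le_mul_of_nonneg_left (measureReal_mono ?_) hl.le
  rintro ω ⟨t, ht, hlt⟩
  have : ¬ ∀ s ≤ N, d s (fun i t => G i t ω) < l := by
    push Not
    exact ⟨t, ht, hlt⟩
  simp only [Set.mem_ofPred_eq, hW, if_neg this, le_refl]

end Moments

end Deviation

/-! ### Cumulated and one-step deviations -/

section Bounds

variable {n M : ℕ} {Ω : Type*} [MeasurableSpace Ω] {P : Measure Ω} [IsProbabilityMeasure P]
  {G : Fin M → ℕ → Ω → Fin n} {A : ℝ}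

lemma div_sub_fluid_sq (n t u : ℕ) :
    ((u : ℝ) / n - fluid t) ^ 2 = fluid t ^ 2 * relDev n t u ^ 2 := by
  have := fluid_pos t
  rw [relDev]
  field_simp

/-- The factor `fluid t ^ 2` cancels the growth t² of the relative second moment, leaving a bound
uniform in t. -/
lemma integral_sub_fluid_sq_le (hG : IsUniformMoves P G) (v₀ : Fin n) (hA : 0 ≤ A)
    (hn : 1 ≤ n) (hM : |(M : ℝ) - n / 2| ≤ A * √n) (hMn : (M : ℝ) ≤ 3 / 5 * n) {t : ℕ}
    (ht : (t : ℝ) ≤ √n) :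
    ∫ ω, ((numUnhappy v₀ (fun i t => G i t ω) t : ℝ) / n - fluid t) ^ 2 ∂P ≤ devConst A / n := by
  have hn0 : (1 : ℝ) ≤ n := by exact_mod_cast hn
  simp only [div_sub_fluid_sq]
  rw [integral_const_mul]
  have hf := fluid_pos t
  rcases Nat.eq_zero_or_pos t with rfl | ht0
  · simp only [numUnhappy_zero, integral_const, probReal_univ, one_smul]
    have h1 := relDev_zero_sq_le hn hM
    have h2 : 4 * A ^ 2 ≤ devConst A := by
      have hg := growth_nonneg hA
      have h3 := Real.one_le_exp hg
      have h4 : 0 ≤ 4 * A ^ 2 := by positivity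
      unfold devConst
      nlinarith
    have h3 : fluid 0 ^ 2 ≤ 1 := pow_le_one₀ hf.le (by linarith [fluid_le_half 0])
    calc _ ≤ 1 * (4 * A ^ 2 / n) := by gcongr
      _ ≤ _ := by rw [one_mul]; gcongr
  · have h1 := integral_relDev_sq_le hG v₀ hA hn hM hMn ht0 ht
    have h2 : fluid t * t ≤ 1 := by
      have := fluid_le t
      rw [le_div_iff₀ (by positivity)] at this
      linarith
    have hC := devConst_nonneg hA
    calc _ ≤ fluid t ^ 2 * (devConst A * t ^ 2 / n) := by gcongr
      _ = (fluid t * t) ^ 2 * (devConst A / n) := by ring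
      _ ≤ 1 * (devConst A / n) := by
          gcongr
          exact pow_le_one₀ (by positivity) h2
      _ = _ := one_mul _

/-- The cumulated deviation from the fluid limit is small. -/
theorem measureReal_sum_sub_fluid_le (hG : IsUniformMoves P G) (v₀ : Fin n) (hA : 0 ≤ A)
    (hn : 1 ≤ n) (hM : |(M : ℝ) - n / 2| ≤ A * √n) (hMn : (M : ℝ) ≤ 3 / 5 * n) {N : ℕ}
    (hN : (N : ℝ) ≤ √n) {η : ℝ} (hη : 0 < η) :
    P.real {ω | η ≤ ∑ t ∈ Finset.range (N + 1),
        |(numUnhappy v₀ (fun i t => G i t ω) t : ℝ) / n - fluid t|}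
      ≤ devConst A * (N + 1) ^ 2 / n / η ^ 2 := by
  set D : ℕ → (Fin M → ℕ → Fin n) → ℝ := fun t g => |(numUnhappy v₀ g t : ℝ) / n - fluid t| with hD
  have hdep : ∀ t, DependsUpTo t fun g => D t g ^ 2 := fun t =>
    (dependsUpTo_numUnhappy v₀ t).comp fun u => |(u : ℝ) / n - fluid t| ^ 2
  have hint : ∀ t, Integrable (fun ω => D t (fun i t => G i t ω) ^ 2) P := fun t =>
    hG.integrable v₀ (hdep t)
  have hI : ∀ t ∈ Finset.range (N + 1), ∫ ω, D t (fun i t => G i t ω) ^ 2 ∂P ≤ devConst A / n := by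
    intro t ht
    simp only [hD, sq_abs]
    refine integral_sub_fluid_sq_le hG v₀ hA hn hM hMn (le_trans ?_ hN)
    exact_mod_cast Nat.lt_succ_iff.1 (Finset.mem_range.1 ht)
  -- By Cauchy–Schwarz `f` dominates the square of the cumulated deviation.
  set f : Ω → ℝ := fun ω => (N + 1) * ∑ t ∈ Finset.range (N + 1), D t (fun i t => G i t ω) ^ 2
    with hf
  have hfint : Integrable f P := (integrable_finsetSum _ fun t _ => hint t).const_mul _
  have hfle : ∫ ω, f ω ∂P ≤ devConst A * (N + 1) ^ 2 / n := by
    rw [hf, integral_const_mul, integral_finsetSum _ fun t _ => hint t]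
    calc _ ≤ ((N : ℝ) + 1) * ∑ _t ∈ Finset.range (N + 1), devConst A / n := by
          gcongr with t ht
          exact hI t ht
      _ = _ := by
          rw [Finset.sum_const, Finset.card_range, nsmul_eq_mul]
          push_cast
          ring
  have hmarkov := mul_meas_ge_le_integral_of_nonneg
    (Eventually.of_forall fun ω => show 0 ≤ f ω by rw [hf]; positivity) hfint (η ^ 2)
  rw [le_div_iff₀ (by positivity), mul_comm]
  refine le_trans ?_ (hmarkov.trans hfle)
  refine mul_le_mul_of_nonneg_left (measureReal_mono ?_) (by positivity)
  intro ω hω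
  have h1 : η ≤ ∑ t ∈ Finset.range (N + 1), D t (fun i t => G i t ω) := hω
  have h2 := sq_sum_le_card_mul_sum_sq (s := Finset.range (N + 1))
    (f := fun t => D t (fun i t => G i t ω))
  rw [Finset.card_range] at h2
  have h3 : η ^ 2 ≤ f ω := by
    calc η ^ 2 ≤ (∑ t ∈ Finset.range (N + 1), D t (fun i t => G i t ω)) ^ 2 := by gcongr
      _ ≤ _ := h2
      _ = f ω := by rw [hf]; push_cast; rfl
  exact h3

-- The deviation is measured in units of √u, so u cancels from the subgaussian exponent and the
-- bound is uniform over the random past.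
open Classical in
lemma measureReal_one_step_le (hG : IsUniformMoves P G) (v₀ : Fin n) {w : ℝ} (hw : 0 ≤ w)
    (t : ℕ) :
    P.real {ω | 0 < numUnhappy v₀ (fun i t => G i t ω) t ∧
        w * √(numUnhappy v₀ (fun i t => G i t ω) t : ℝ) ≤
          |(numUnhappy v₀ (fun i t => G i t ω) (t + 1) : ℝ)
            - stepMean n M (numUnhappy v₀ (fun i t => G i t ω) t)|}
      ≤ 2 * Real.exp (-(w ^ 2 / 8)) := by
  have : Nonempty (Fin n) := ⟨v₀⟩
  set φ : ℕ → ℕ → ℝ := fun u u' =>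
    if 0 < u ∧ w * √(u : ℝ) ≤ |(u' : ℝ) - stepMean n M u| then 1 else 0 with hφ
  have hφ0 : ∀ u u', 0 ≤ φ u u' := by
    intro u u'
    simp only [hφ]
    split_ifs <;> norm_num
  set Φ : (Fin M → ℕ → Fin n) → (Fin M → Fin n) → ℝ := fun g a =>
    φ (state v₀ g t).2.card (collided (moved (state v₀ g t).1 (state v₀ g t).2 a)).card with hΦ
  have hdep : DependsUpTo t Φ := (dependsUpTo_state v₀ t).comp
    fun σ a => φ σ.2.card (collided (moved σ.1 σ.2 a)).card
  have hdep' : DependsUpTo (t + 1) fun g : Fin M → ℕ → Fin n => Φ g fun i => g i (t + 1) := by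
    intro g g' hg
    have h1 : Φ g = Φ g' := hdep.mono t.le_succ g g' hg
    have h2 : (fun i => g i (t + 1)) = fun i => g' i (t + 1) :=
      funext fun i => hg i _ le_rfl
    simp only [h1, h2]
  have hstep := hG.integral_step v₀ Φ hdep
  have hexp : ∀ g, 𝔼 a, Φ g a ≤ 2 * Real.exp (-(w ^ 2 / 8)) := by
    intro g
    by_cases hu : 0 < (state v₀ g t).2.card
    · simp only [hΦ, hφ, hu, true_and]
      refine (expect_tail_card_collided_moved_le _ _ (injOn_state v₀ g t) hu
        (by positivity)).trans_eq ?_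
      have hu' : (0 : ℝ) < (state v₀ g t).2.card := by exact_mod_cast hu
      rw [mul_pow, Real.sq_sqrt hu'.le]
      congr 3
      field_simp
    · simp only [hΦ, hφ, hu, false_and, if_false, Fintype.expect_const]
      positivity
  have hmarkov := mul_meas_ge_le_integral_of_nonneg
    (Eventually.of_forall fun ω => hφ0 (state v₀ (fun i t => G i t ω) t).2.card
      (collided (moved (state v₀ (fun i t => G i t ω) t).1 (state v₀ (fun i t => G i t ω) t).2
        fun i => G i (t + 1) ω)).card) (hG.integrable v₀ hdep') 1
  rw [one_mul] at hmarkov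
  calc _ ≤ P.real {ω | 1 ≤ Φ (fun i s => G i s ω) (fun i => G i (t + 1) ω)} := by
        refine measureReal_mono ?_
        intro ω hω
        change 1 ≤ φ _ _
        simp only [hφ]
        rw [if_pos]
        exact hω
    _ ≤ _ := hmarkov
    _ = _ := hstep
    _ ≤ ∫ _, 2 * Real.exp (-(w ^ 2 / 8)) ∂P :=
        integral_mono (hG.integrable v₀ hdep.expect) (integrable_const _) fun ω => hexp _
    _ = _ := by simp

/-- All steps up to `N` stay close to their means. -/
theorem measureReal_exists_one_step_le (hG : IsUniformMoves P G) (v₀ : Fin n) {w : ℝ} (hw : 0 ≤ w)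
    (N : ℕ) :
    P.real {ω | ∃ t < N, 0 < numUnhappy v₀ (fun i t => G i t ω) t ∧
        w * √(numUnhappy v₀ (fun i t => G i t ω) t : ℝ) ≤
          |(numUnhappy v₀ (fun i t => G i t ω) (t + 1) : ℝ)
            - stepMean n M (numUnhappy v₀ (fun i t => G i t ω) t)|}
      ≤ N * (2 * Real.exp (-(w ^ 2 / 8))) := by
  have hU : {ω | ∃ t < N, 0 < numUnhappy v₀ (fun i t => G i t ω) t ∧
        w * √(numUnhappy v₀ (fun i t => G i t ω) t : ℝ) ≤
          |(numUnhappy v₀ (fun i t => G i t ω) (t + 1) : ℝ)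
            - stepMean n M (numUnhappy v₀ (fun i t => G i t ω) t)|}
      = ⋃ t ∈ Finset.range N, {ω | 0 < numUnhappy v₀ (fun i t => G i t ω) t ∧
        w * √(numUnhappy v₀ (fun i t => G i t ω) t : ℝ) ≤
          |(numUnhappy v₀ (fun i t => G i t ω) (t + 1) : ℝ)
            - stepMean n M (numUnhappy v₀ (fun i t => G i t ω) t)|} := by
    ext ω
    simp only [Set.mem_iUnion, Finset.mem_range, exists_prop, Set.mem_ofPred_eq]
  rw [hU]
  refine (measureReal_biUnion_finset_le _ _).trans ?_
  refine (Finset.sum_le_sum fun t _ => measureReal_one_step_le hG v₀ hw t).trans_eq ?_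
  rw [Finset.sum_const, Finset.card_range, nsmul_eq_mul]

end Bounds

lemma hitTime_eq {n M : ℕ} (v₀ : Fin n) (g : Fin M → ℕ → Fin n) {δ : ℝ} {T : ℕ} (hT : 0 < T)
    (hTle : (numUnhappy v₀ g T : ℝ) ≤ √(n : ℝ) / δ)
    (hlt : ∀ t, 0 < t → t < T → √(n : ℝ) / δ < numUnhappy v₀ g t) :
    hitTime v₀ g δ = T := by
  refine le_antisymm (sInf_le ⟨T, ⟨hT, hTle⟩, rfl⟩) (le_sInf ?_)
  rintro _ ⟨t, ⟨ht, htle⟩, rfl⟩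
  by_contra h
  have h' : t < T := by
    rw [not_le] at h
    exact ENat.natCast_lt_natCast.1 h
  exact absurd htle (not_le.2 (hlt t ht h'))

/-! ### The hitting time -/

lemma tendsto_sqrt_natCast : Tendsto (fun n : ℕ => √(n : ℝ)) atTop atTop :=
  Real.tendsto_sqrt_atTop.comp tendsto_natCast_atTop_atTop

/-- Used with c = (1 ± ε)(4/7)δ, where the limit is 1/((1 ± ε)δ), strictly on either side of the
threshold 1/δ. -/
lemma tendsto_fluid_floor {c : ℝ} (hc : 0 < c) :
    Tendsto (fun n : ℕ => fluid ⌊c * √(n : ℝ)⌋₊ * √(n : ℝ)) atTop (𝓝 (4 / 7 / c)) := by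
  have hs := tendsto_sqrt_natCast
  have h1 : Tendsto (fun n : ℕ => (⌊c * √(n : ℝ)⌋₊ : ℝ) / √(n : ℝ)) atTop (𝓝 c) :=
    (tendsto_nat_floor_mul_div_atTop hc.le).comp hs
  have h2 : Tendsto (fun n : ℕ => ⌊c * √(n : ℝ)⌋₊) atTop atTop :=
    tendsto_nat_floor_atTop.comp (hs.const_mul_atTop hc)
  have h3 := (tendsto_mul_fluid.comp h2).div h1 hc.ne'
  refine h3.congr' ?_
  filter_upwards [h2.eventually_ge_atTop 1, hs.eventually_gt_atTop 0] with n hn hn0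
  have : (0 : ℝ) < (⌊c * √(n : ℝ)⌋₊ : ℝ) := by exact_mod_cast hn
  simp only [Pi.div_apply, Function.comp]
  field_simp

/-- The scale `n ^ (1 / 16)` of the one-step deviations that are allowed. -/
noncomputable def slack (n : ℕ) : ℝ := (n : ℝ) ^ (1 / 16 : ℝ)

lemma slack_nonneg (n : ℕ) : 0 ≤ slack n := by unfold slack; positivity

lemma slack_pow (n : ℕ) : slack n ^ 8 = √(n : ℝ) := by
  rw [slack, ← Real.rpow_natCast, ← Real.rpow_mul (Nat.cast_nonneg n), Real.sqrt_eq_rpow]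
  norm_num

lemma tendsto_slack : Tendsto slack atTop atTop :=
  (tendsto_rpow_atTop (by norm_num)).comp tendsto_natCast_atTop_atTop

lemma eventually_exp_slack_le {δ : ℝ} (hδ : 0 < δ) :
    ∀ᶠ n : ℕ in atTop, √(n : ℝ) * (2 * Real.exp (-(slack n ^ 2 / 8))) ≤ δ := by
  have h1 : Tendsto (fun n => slack n ^ 2 / 8) atTop atTop :=
    ((tendsto_pow_atTop two_ne_zero).comp tendsto_slack).atTop_div_const (by norm_num)
  -- With y = `slack n ^ 2 / 8`, √n = `slack n ^ 8` equals 8⁴y⁴.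
  have h2 := ((Real.tendsto_pow_mul_exp_neg_atTop_nhds_zero 4).comp h1).const_mul (2 * 8 ^ 4)
  rw [mul_zero] at h2
  filter_upwards [h2.eventually_le_const hδ] with n hn
  refine le_trans (le_of_eq ?_) hn
  rw [← slack_pow]
  simp only [Function.comp]
  ring

/-- In terms of w = `slack n` and for fixed δ, the left side has order w⁵ and the right side order
w⁶. -/
lemma eventually_le_overshoot (a b : ℝ) {δ : ℝ} (hδ : 0 < δ) :
    ∀ᶠ n : ℕ in atTop,
      a + b + 2 * slack n * √(√(n : ℝ) / δ) ≤ 1 / slack n ^ 2 * (√(n : ℝ) / δ) := by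
  have h : ∀ᶠ w : ℝ in atTop, δ * (a + b + 2 * w * (w ^ 4 / √δ)) ≤ w ^ 6 := by
    filter_upwards [eventually_ge_atTop 1,
      eventually_ge_atTop (δ * (|a| + |b|) + δ * (2 / √δ))] with w hw1 hw
    have hsδ : 0 < √δ := Real.sqrt_pos.2 hδ
    have h5 : (1 : ℝ) ≤ w ^ 5 := one_le_pow₀ hw1
    calc _ = δ * (a + b) * 1 + δ * (2 / √δ) * w ^ 5 := by ring
      _ ≤ δ * (|a| + |b|) * w ^ 5 + δ * (2 / √δ) * w ^ 5 := by
          gcongr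
          · exact le_abs_self a
          · exact le_abs_self b
      _ = (δ * (|a| + |b|) + δ * (2 / √δ)) * w ^ 5 := by ring
      _ ≤ w * w ^ 5 := by gcongr
      _ = _ := by ring
  filter_upwards [tendsto_slack.eventually h, tendsto_slack.eventually_gt_atTop 0] with n hn hw
  have h1 : √(√(n : ℝ) / δ) = slack n ^ 4 / √δ := by
    rw [Real.sqrt_div' _ hδ.le, ← slack_pow]
    congr 1
    rw [show slack n ^ 8 = (slack n ^ 4) ^ 2 by ring]
    exact Real.sqrt_sq (by positivity)
  rw [h1, ← slack_pow]
  have h2 : 1 / slack n ^ 2 * (slack n ^ 8 / δ) = slack n ^ 6 / δ := by field_simp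
  rw [h2, le_div_iff₀ hδ]
  linarith

/-- One step that stays close to its mean does not drop far below the level `√n / δ`. -/
lemma sub_le_of_step_close {n M u u' : ℕ} {A δ : ℝ} (hδ : 0 < δ) (hA : 0 ≤ A) (hn : 1 ≤ n)
    (hM : |(M : ℝ) - n / 2| ≤ A * √n) (hMn : M ≤ n) (hu : u ≤ M) (hu4 : (u : ℝ) ≤ 4 * (√n / δ))
    (hstep : |(u' : ℝ) - stepMean n M u| ≤ slack n * √(u : ℝ))
    (hover : 28 / δ ^ 2 + 4 * (2 * A + 3) / δ + 2 * slack n * √(√(n : ℝ) / δ)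
      ≤ 1 / slack n ^ 2 * (√(n : ℝ) / δ)) :
    (u : ℝ) - u' ≤ 1 / slack n ^ 2 * (√(n : ℝ) / δ) := by
  have hn0 : (1 : ℝ) ≤ n := by exact_mod_cast hn
  have hs1 : 1 ≤ √(n : ℝ) := Real.one_le_sqrt.2 hn0
  have hs2 : √(n : ℝ) ^ 2 = n := Real.sq_sqrt (by linarith)
  have huM : (u : ℝ) ≤ M := by exact_mod_cast hu
  have hMn' : (M : ℝ) ≤ n := by exact_mod_cast hMn
  have hst := (abs_le.1 hstep).1
  have hmean := (abs_le.1 (abs_stepMean_div_sub_drift_le hn hM hMn hu)).1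
  have hun : (u : ℝ) / n ≤ 1 := by
    rw [div_le_one (by linarith)]
    linarith
  have hdr := le_drift (x := (u : ℝ) / n) (by positivity) hun
  have hmean2 : (u : ℝ) - 7 / 4 * (u : ℝ) ^ 2 / n - (2 * A + 3) * u / √n ≤ stepMean n M u := by
    have h1 : (u : ℝ) / n - 7 / 4 * ((u : ℝ) / n) ^ 2 - (2 * A + 3) * (u / n) / √n
        ≤ stepMean n M u / n := by linarith
    rw [le_div_iff₀ (by linarith)] at h1
    refine le_trans (le_of_eq ?_) h1
    field_simp
  -- The systematic decrease near the threshold is bounded: 28 = (7/4) · 4².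
  have h7 : 7 / 4 * (u : ℝ) ^ 2 / n ≤ 28 / δ ^ 2 := by
    calc _ ≤ 7 / 4 * (4 * (√n / δ)) ^ 2 / n := by gcongr
      _ = 28 * √n ^ 2 / n / δ ^ 2 := by ring
      _ = _ := by rw [hs2, mul_div_cancel_right₀ _ (by linarith)]
  have h8 : (2 * A + 3) * u / √n ≤ 4 * (2 * A + 3) / δ := by
    calc _ ≤ (2 * A + 3) * (4 * (√n / δ)) / √n := by gcongr
      _ = _ := by field_simp
  have h9 : slack n * √(u : ℝ) ≤ 2 * slack n * √(√n / δ) := by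
    have : √(u : ℝ) ≤ 2 * √(√n / δ) := by
      calc _ ≤ √(4 * (√n / δ)) := Real.sqrt_le_sqrt hu4
        _ = _ := by
          rw [Real.sqrt_mul (by norm_num), show (4 : ℝ) = 2 ^ 2 by norm_num,
            Real.sqrt_sq (by norm_num)]
    have := mul_le_mul_of_nonneg_left this (slack_nonneg n)
    linarith
  linarith

/-- The cumulated number of unhappy particles up to a time close to `4 / 7 * δ * √n`. -/
lemma abs_sum_sub_le_of_close {n T N : ℕ} {ε δ c : ℝ} (hε : 0 < ε) (hε4 : ε ≤ 1 / 4) (hδ : 0 < δ)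
    (hn : 1 ≤ n) (hT0 : 0 < T) (hTN : T ≤ N)
    (hTlow : (1 - ε) * (4 / 7 * δ * √(n : ℝ)) ≤ T) (hTup : T ≤ (1 + ε) * (4 / 7 * δ * √(n : ℝ)))
    (hsum : |∑ t ∈ Finset.range (T + 1), fluid t - 4 / 7 * Real.log T - c| ≤ ε / 16) (U : ℕ → ℕ)
    (hcum : ∑ t ∈ Finset.range (N + 1), |(U t : ℝ) / n - fluid t| ≤ ε / 16) :
    |(∑ t ∈ Finset.range (T + 1), (U t : ℝ))
        - (2 / 7 * n * Real.log n + 4 / 7 * n * Real.log δ + (c + 4 / 7 * Real.log (4 / 7)) * n)|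
          ≤ ε * n := by
  have hn0 : (1 : ℝ) ≤ n := by exact_mod_cast hn
  have hs1 : 1 ≤ √(n : ℝ) := Real.one_le_sqrt.2 hn0
  set T₀ := 4 / 7 * δ * √(n : ℝ) with hT₀
  have hT₀0 : 0 < T₀ := by positivity
  have hTpos : (0 : ℝ) < T := by exact_mod_cast hT0
  have hlogT₀ : Real.log T₀ = Real.log (4 / 7) + Real.log δ + Real.log n / 2 := by
    rw [hT₀, Real.log_mul (by positivity) (by positivity), Real.log_mul (by norm_num) hδ.ne',
      Real.log_sqrt (by linarith)]
  have hlog1 : Real.log T - Real.log T₀ ≤ ε := by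
    rw [← Real.log_div hTpos.ne' hT₀0.ne']
    refine (Real.log_le_sub_one_of_pos (by positivity)).trans ?_
    rw [div_sub_one hT₀0.ne', div_le_iff₀ hT₀0]
    linarith
  have hlog2 : Real.log T₀ - Real.log T ≤ 4 / 3 * ε := by
    rw [← Real.log_div hT₀0.ne' hTpos.ne']
    refine (Real.log_le_sub_one_of_pos (by positivity)).trans ?_
    rw [div_sub_one hTpos.ne', div_le_iff₀ hTpos]
    nlinarith [mul_le_mul_of_nonneg_left hTlow hε.le, mul_pos hε hT₀0]
  have hfl := abs_le.1 (hsum)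
  have hdiff : |∑ t ∈ Finset.range (T + 1), ((U t : ℝ) / n - fluid t)| ≤ ε / 16 := by
    refine (Finset.abs_sum_le_sum_abs _ _).trans (le_trans ?_ hcum)
    refine Finset.sum_le_sum_of_subset_of_nonneg ?_ fun _ _ _ => abs_nonneg _
    exact Finset.range_subset_range.2 (by omega)
  rw [Finset.sum_sub_distrib, ← Finset.sum_div] at hdiff
  have hd := abs_le.1 hdiff
  set total := ∑ t ∈ Finset.range (T + 1), (U t : ℝ) with htotal
  -- The error shares are at most (4/7)(4/3)ε from the logarithm and ε/16 each from the orbit's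
  -- constant and the random deviation, below ε in total.
  have hkey : |total / n - (2 / 7 * Real.log n + 4 / 7 * Real.log δ
      + (c + 4 / 7 * Real.log (4 / 7)))| ≤ ε := by
    rw [abs_le]
    constructor <;> linarith [hd.1, hd.2, hfl.1, hfl.2]
  have hmul : total - (2 / 7 * n * Real.log n + 4 / 7 * n * Real.log δ
      + (c + 4 / 7 * Real.log (4 / 7)) * n)
      = (total / n - (2 / 7 * Real.log n + 4 / 7 * Real.log δ
      + (c + 4 / 7 * Real.log (4 / 7)))) * n := by
    field_simp
  rw [hmul, abs_mul, abs_of_nonneg (show (0 : ℝ) ≤ n by linarith)]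
  gcongr

/-- Consequences of staying close to the fluid limit for the first time at which a sequence drops
below `√n / δ`. -/
lemma exists_hit_of_close {n M : ℕ} {A ε δ c : ℝ} (hε : 0 < ε) (hε4 : ε ≤ 1 / 4) (hδ : 0 < δ)
    (hn : 1 ≤ n) (hM : |(M : ℝ) - n / 2| ≤ A * √n) (hMn : (M : ℝ) ≤ 3 / 5 * n) (hA : 0 ≤ A)
    (hearly : 2 ≤ (1 - ε) * (4 / 7 * δ * √(n : ℝ)))
    (hup : fluid ⌊(1 + ε) * (4 / 7 * δ) * √(n : ℝ)⌋₊ * √(n : ℝ) * (1 + ε / 2) ≤ 1 / δ)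
    (hlow : 1 / δ ≤ fluid ⌊(1 - ε) * (4 / 7 * δ) * √(n : ℝ)⌋₊ * √(n : ℝ) * (1 - ε / 2))
    (hover : 28 / δ ^ 2 + 4 * (2 * A + 3) / δ + 2 * slack n * √(√(n : ℝ) / δ)
      ≤ 1 / slack n ^ 2 * (√(n : ℝ) / δ))
    (hsum : ∀ T : ℕ, (1 - ε) * (4 / 7 * δ * √(n : ℝ)) ≤ T →
      |∑ t ∈ Finset.range (T + 1), fluid t - 4 / 7 * Real.log T - c| ≤ ε / 16)
    (U : ℕ → ℕ) (hUM : ∀ t, U t ≤ M)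
    (hdev : ∀ t ≤ ⌊δ * √(n : ℝ)⌋₊, |relDev n t (U t)| ≤ ε / 16)
    (hcum : ∑ t ∈ Finset.range (⌊δ * √(n : ℝ)⌋₊ + 1), |(U t : ℝ) / n - fluid t| ≤ ε / 16)
    (hstep : ∀ t < ⌊δ * √(n : ℝ)⌋₊, 0 < U t →
      |(U (t + 1) : ℝ) - stepMean n M (U t)| ≤ slack n * √(U t : ℝ)) :
    ∃ T : ℕ, (0 < T ∧ (U T : ℝ) ≤ √(n : ℝ) / δ ∧ ∀ t, 0 < t → t < T → √(n : ℝ) / δ < U t) ∧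
      |(U T : ℝ) - √(n : ℝ) / δ| ≤ 1 / slack n ^ 2 * (√(n : ℝ) / δ) ∧
      |(T : ℝ) - 4 / 7 * δ * √(n : ℝ)| ≤ ε * (4 / 7 * δ * √(n : ℝ)) ∧
      |(∑ t ∈ Finset.range (T + 1), (U t : ℝ))
        - (2 / 7 * n * Real.log n + 4 / 7 * n * Real.log δ + (c + 4 / 7 * Real.log (4 / 7)) * n)|
          ≤ ε * n := by
  have hn0 : (1 : ℝ) ≤ n := by exact_mod_cast hn
  have hs1 : 1 ≤ √(n : ℝ) := Real.one_le_sqrt.2 hn0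
  have hs2 : √(n : ℝ) ^ 2 = n := Real.sq_sqrt (by linarith)
  set s := √(n : ℝ) with hs
  set N := ⌊δ * s⌋₊ with hN
  set L := s / δ with hL
  have hL0 : 0 < L := by positivity
  set T₀ := 4 / 7 * δ * s with hT₀
  have hT₀0 : 0 < T₀ := by positivity
  have hrel : ∀ t ≤ N, (1 - ε / 16) * fluid t ≤ (U t : ℝ) / n ∧
      (U t : ℝ) / n ≤ (1 + ε / 16) * fluid t := by
    intro t ht
    have h1 := abs_le.1 (hdev t ht)
    have hf := fluid_pos t
    rw [relDev, le_div_iff₀ hf, div_le_iff₀ hf] at h1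
    constructor <;> linarith [h1.1, h1.2]
  have hLn : L / n = 1 / δ / s := by
    rw [hL, ← hs2]
    field_simp
  set tp := ⌊(1 + ε) * (4 / 7 * δ) * s⌋₊ with htp
  -- As ε ≤ 1/4, (1 + ε)(4/7) ≤ 5/7, so the horizon δ√n reaches beyond the expected hitting time.
  have htpN : tp ≤ N := by
    refine Nat.floor_le_floor ?_
    have h1 : 0 < δ * s := by positivity
    have h2 := mul_le_mul_of_nonneg_right (show (1 + ε) * (4 / 7) ≤ 1 by linarith) h1.le
    linarith
  have htple : (tp : ℝ) ≤ (1 + ε) * T₀ := by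
    refine (Nat.floor_le (by positivity)).trans_eq ?_
    rw [hT₀]
    ring
  have htp0 : 0 < tp := by
    refine Nat.floor_pos.2 ?_
    have : (1 + ε) * (4 / 7 * δ) * s = (1 + ε) * T₀ := by rw [hT₀]; ring
    rw [this]
    linarith [mul_pos hε hT₀0]
  have hUtp : (U tp : ℝ) ≤ L := by
    have h1 := (hrel tp htpN).2
    have h2 : fluid tp * (1 + ε / 2) ≤ L / n := by
      rw [hLn, le_div_iff₀ (by linarith)]
      linarith
    have h3 : (1 + ε / 16) * fluid tp ≤ fluid tp * (1 + ε / 2) := by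
      linarith [mul_pos hε (fluid_pos tp)]
    have h4 : (U tp : ℝ) / n ≤ L / n := by linarith
    exact (div_le_div_iff_of_pos_right (by linarith)).1 h4
  have hex : ∃ t, 0 < t ∧ (U t : ℝ) ≤ L := ⟨tp, htp0, hUtp⟩
  obtain ⟨T, ⟨hT0, hTL⟩, hTfind⟩ : ∃ T, (0 < T ∧ (U T : ℝ) ≤ L) ∧
      ∀ t < T, ¬(0 < t ∧ (U t : ℝ) ≤ L) := by
    classical
    exact ⟨Nat.find hex, Nat.find_spec hex, fun t ht => Nat.find_min hex ht⟩
  have hTmin : ∀ t, 0 < t → t < T → L < U t := fun t ht htT =>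
    not_le.1 fun h => hTfind t htT ⟨ht, h⟩
  have hTtp : T ≤ tp := not_lt.1 fun h => hTfind tp h ⟨htp0, hUtp⟩
  have hTN : T ≤ N := hTtp.trans htpN
  have hTup : (T : ℝ) ≤ (1 + ε) * T₀ := le_trans (by exact_mod_cast hTtp) htple
  have hTfl : (1 - ε / 16) * fluid T ≤ L / n :=
    (hrel T hTN).1.trans (by gcongr)
  -- Before this time the orbit exceeds the threshold by a factor 1/(1 - ε/2), more than a relative
  -- deviation of ε/16 can undo.
  have hTlow : (1 - ε) * T₀ ≤ T := by
    by_contra hlt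
    rw [not_le] at hlt
    have h1 : T ≤ ⌊(1 - ε) * (4 / 7 * δ) * s⌋₊ := by
      refine Nat.le_floor (hlt.le.trans_eq ?_)
      rw [hT₀]
      ring
    have h2 := antitone_fluid h1
    set x := fluid ⌊(1 - ε) * (4 / 7 * δ) * s⌋₊ with hx
    have hx0 : 0 < x := fluid_pos _
    have h3 : L / n ≤ x * (1 - ε / 2) := by
      rw [hLn, div_le_iff₀ (by linarith)]
      linarith
    have h4 := mul_le_mul_of_nonneg_left h2 (show 0 ≤ 1 - ε / 16 by linarith)
    have h5 := mul_pos hε hx0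
    linarith
  -- The minimality of T concerns positive times only, so the predecessor of T must be positive.
  have hT2 : 2 ≤ T := by
    have : (2 : ℝ) ≤ T := hearly.trans hTlow
    exact_mod_cast this
  refine ⟨T, ⟨hT0, hTL, hTmin⟩, ?_, ?_, ?_⟩
  · obtain ⟨k, hk⟩ : ∃ k, T = k + 1 := ⟨T - 1, by omega⟩
    have hkL : L < U k := hTmin k (by omega) (by omega)
    have hk0 : 0 < U k := by
      have : (0 : ℝ) < U k := hL0.trans hkL
      exact_mod_cast this
    -- The orbit loses at most a factor 3 per step, and the two relative errors fit into the
    -- remaining 4/3.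
    have hk4 : (U k : ℝ) ≤ 4 * L := by
      have h1 := (hrel k (by omega)).2
      have h2 := fluid_le_three_mul_succ k
      rw [← hk] at h2
      have h3 := fluid_pos T
      have h4 : (U k : ℝ) / n ≤ 4 * L / n := by
        calc _ ≤ (1 + ε / 16) * (3 * fluid T) := h1.trans (by gcongr)
          _ ≤ 4 * ((1 - ε / 16) * fluid T) := by
              linarith [mul_le_mul_of_nonneg_right hε4 h3.le]
          _ ≤ 4 * (L / n) := by gcongr
          _ = _ := by ring
      exact (div_le_div_iff_of_pos_right (by linarith)).1 h4
    have hMn2 : M ≤ n := by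
      have : (M : ℝ) ≤ n := by linarith
      exact_mod_cast this
    have hdrop := sub_le_of_step_close hδ hA hn hM hMn2 (hUM k) hk4 (hstep k (by omega) hk0) hover
    rw [← hk] at hdrop
    rw [abs_le]
    constructor
    · linarith
    · have : 0 ≤ 1 / slack n ^ 2 * L := by positivity
      linarith
  · rw [abs_le]
    constructor <;> linarith
  · exact abs_sum_sub_le_of_close hε hε4 hδ hn hT0 hTN hTlow hTup (hsum T hTlow) U hcum

end Dispersion

/-! ### Choice of constants and union bound -/

theorem lemma4p1 :
    ∃ (χ : ℝ) (r : ℕ → ℝ), Tendsto r atTop (𝓝 0) ∧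
      ∀ (ε : ℝ), 0 < ε → ∀ (α : ℝ) (M : ℕ → ℕ),
        ((fun n : ℕ => (M n : ℝ) - ((n : ℝ) / 2 + α * √(n : ℝ))) =o[atTop]
          fun n : ℕ => √(n : ℝ)) →
        ∀ᶠ δ : ℝ in 𝓝[>] 0, ∀ᶠ n : ℕ in atTop,
          ∀ (Ω : Type*) [MeasurableSpace Ω] (P : Measure Ω) [IsProbabilityMeasure P]
            (v₀ : Fin n) (G : Fin (M n) → ℕ → Ω → Fin n), Dispersion.IsUniformMoves P G →
            1 - δ ≤ P.real {ω | ∃ T : ℕ,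
              Dispersion.hitTime v₀ (fun i t => G i t ω) δ = (T : ℕ∞) ∧
              |(Dispersion.numUnhappy v₀ (fun i t => G i t ω) T : ℝ) - √(n : ℝ) / δ|
                ≤ r n * (√(n : ℝ) / δ) ∧
              |(T : ℝ) - 4 / 7 * δ * √(n : ℝ)| ≤ ε * (4 / 7 * δ * √(n : ℝ)) ∧
              |(∑ t ∈ Finset.range (T + 1),
                  (Dispersion.numUnhappy v₀ (fun i t => G i t ω) t : ℝ))
                - (2 / 7 * n * Real.log n + 4 / 7 * n * Real.log δ + χ * n)| ≤ ε * n} := by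
  obtain ⟨c, hc⟩ := Dispersion.exists_tendsto_sum_fluid_sub_log
  -- The extra logarithm comes from evaluating (4/7) log T at T = (4/7)δ√n; the error sequence is
  -- n^(-1/8).
  refine ⟨c + 4 / 7 * Real.log (4 / 7), fun n => 1 / Dispersion.slack n ^ 2, ?_, ?_⟩
  · simp only [one_div]
    exact tendsto_inv_atTop_zero.comp
      ((tendsto_pow_atTop two_ne_zero).comp Dispersion.tendsto_slack)
  intro ε₀ hε₀ α M hM
  set ε := min ε₀ (1 / 4) with hεdef
  have hε : 0 < ε := lt_min hε₀ (by norm_num)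
  have hε4 : ε ≤ 1 / 4 := min_le_right _ _
  have hεε₀ : ε ≤ ε₀ := min_le_left _ _
  set A := |α| + 1 with hAdef
  have hA : 0 ≤ A := by positivity
  have hC := Dispersion.devConst_nonneg hA
  set C := Dispersion.devConst A with hCdef
  have hη : 0 < ε / 16 := by positivity
  -- Below this bound 5Cδ²/(ε/16)² ≤ δ/2: one Cδ² comes from the maximal inequality and, as N + 1 ≤
  -- 2N, four from the cumulated deviation.
  have hδ₁ : 0 < (ε / 16) ^ 2 / (10 * (C + 1)) := by positivity
  filter_upwards [Ioo_mem_nhdsGT (show (0 : ℝ) < min 1 ((ε / 16) ^ 2 / (10 * (C + 1)))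
    from lt_min one_pos hδ₁)] with δ hδmem
  have hδ : 0 < δ := hδmem.1
  have hδ1 : δ < 1 := hδmem.2.trans_le (min_le_left _ _)
  have hδC : 5 * C * δ ^ 2 / (ε / 16) ^ 2 ≤ δ / 2 := by
    have h1 : δ ≤ (ε / 16) ^ 2 / (10 * (C + 1)) := (hδmem.2.trans_le (min_le_right _ _)).le
    rw [le_div_iff₀ (by positivity)] at h1
    rw [div_le_iff₀ (by positivity)]
    nlinarith [mul_le_mul_of_nonneg_left h1 hδ.le, mul_pos hδ hδ]
  have hs := Dispersion.tendsto_sqrt_natCast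
  have hMA : ∀ᶠ n : ℕ in atTop, |(M n : ℝ) - n / 2| ≤ A * √(n : ℝ) := by
    filter_upwards [hM.bound one_pos] with n hn
    rw [Real.norm_eq_abs, Real.norm_eq_abs, abs_of_nonneg (Real.sqrt_nonneg _), one_mul] at hn
    calc |(M n : ℝ) - n / 2|
        = |((M n : ℝ) - ((n : ℝ) / 2 + α * √(n : ℝ))) + α * √(n : ℝ)| := by ring_nf
      _ ≤ √(n : ℝ) + |α * √(n : ℝ)| := (abs_add_le _ _).trans (by gcongr)
      _ = A * √(n : ℝ) := by
          rw [abs_mul, abs_of_nonneg (Real.sqrt_nonneg _), hAdef]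
          ring
  have hT₀ : ∀ b : ℝ, ∀ᶠ n : ℕ in atTop, b ≤ (1 - ε) * (4 / 7 * δ * √(n : ℝ)) := by
    intro b
    have h1 : Tendsto (fun n : ℕ => (1 - ε) * (4 / 7 * δ * √(n : ℝ))) atTop atTop :=
      (hs.const_mul_atTop (by positivity)).const_mul_atTop (by linarith)
    exact h1.eventually_ge_atTop b
  have hup : ∀ᶠ n : ℕ in atTop,
      Dispersion.fluid ⌊(1 + ε) * (4 / 7 * δ) * √(n : ℝ)⌋₊ * √(n : ℝ) * (1 + ε / 2) ≤ 1 / δ := by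
    refine ((Dispersion.tendsto_fluid_floor (c := (1 + ε) * (4 / 7 * δ)) (by positivity)).mul_const
      (1 + ε / 2)).eventually_le_const ?_
    have : 4 / 7 / ((1 + ε) * (4 / 7 * δ)) * (1 + ε / 2) = (1 + ε / 2) / (1 + ε) * (1 / δ) := by
      field_simp
    rw [this]
    refine mul_lt_of_lt_one_left (by positivity) ?_
    rw [div_lt_one (by positivity)]
    linarith
  have hlow : ∀ᶠ n : ℕ in atTop,
      1 / δ ≤ Dispersion.fluid ⌊(1 - ε) * (4 / 7 * δ) * √(n : ℝ)⌋₊ * √(n : ℝ) * (1 - ε / 2) := by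
    have h1 : 0 < 1 - ε := by linarith
    refine ((Dispersion.tendsto_fluid_floor (c := (1 - ε) * (4 / 7 * δ)) (by positivity)).mul_const
      (1 - ε / 2)).eventually_const_le ?_
    have : 4 / 7 / ((1 - ε) * (4 / 7 * δ)) * (1 - ε / 2) = (1 - ε / 2) / (1 - ε) * (1 / δ) := by
      field_simp
    rw [this]
    refine lt_mul_of_one_lt_left (by positivity) ?_
    rw [one_lt_div h1]
    linarith
  obtain ⟨T₁, hT₁⟩ : ∃ T₁ : ℕ, ∀ T ≥ T₁, |∑ t ∈ Finset.range (T + 1), Dispersion.fluid t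
      - 4 / 7 * Real.log T - c| ≤ ε / 16 := by
    have h1 := (tendsto_iff_norm_sub_tendsto_zero.1 hc).eventually_le_const hη
    exact eventually_atTop.1 h1
  filter_upwards [eventually_ge_atTop 1, hMA, hs.eventually_ge_atTop (10 * A),
    hs.eventually_ge_atTop (1 / δ), hT₀ 2, hT₀ T₁, hup, hlow,
    Dispersion.eventually_le_overshoot (28 / δ ^ 2) (4 * (2 * A + 3) / δ) hδ,
    Dispersion.eventually_exp_slack_le (half_pos hδ)]
    with n hn hMn hsA hsδ hearly hlate hupn hlown hover hexp
  intro Ω _ P _ v₀ G hG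
  have hn0 : (1 : ℝ) ≤ n := by exact_mod_cast hn
  have hs2 : √(n : ℝ) ^ 2 = n := Real.sq_sqrt (by linarith)
  have hs0 : 0 ≤ √(n : ℝ) := Real.sqrt_nonneg _
  have hM35 : (M n : ℝ) ≤ 3 / 5 * n := by
    have h1 := (abs_le.1 hMn).2
    nlinarith
  set N := ⌊δ * √(n : ℝ)⌋₊ with hNdef
  have hδs : 1 ≤ δ * √(n : ℝ) := by
    rw [div_le_iff₀ hδ] at hsδ
    linarith
  have hN1 : 1 ≤ N := Nat.one_le_floor_iff _ |>.2 hδs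
  have hNδ : (N : ℝ) ≤ δ * √(n : ℝ) := Nat.floor_le (by positivity)
  have hNs : (N : ℝ) ≤ √(n : ℝ) := hNδ.trans (mul_le_of_le_one_left hs0 hδ1.le)
  have hN1' : (1 : ℝ) ≤ N := by exact_mod_cast hN1
  have hN2 : (N : ℝ) ^ 2 / n ≤ δ ^ 2 := by
    rw [div_le_iff₀ (by linarith)]
    calc (N : ℝ) ^ 2 ≤ (δ * √(n : ℝ)) ^ 2 := by gcongr
      _ = _ := by rw [mul_pow, hs2]
  have hbad₁ := Dispersion.measureReal_exists_relDev_sq_le hG v₀ hA hn hMn hM35 hN1 hNs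
    (l := (ε / 16) ^ 2) (by positivity)
  have hbad₂ := Dispersion.measureReal_sum_sub_fluid_le hG v₀ hA hn hMn hM35 hNs hη
  have hbad₃ := Dispersion.measureReal_exists_one_step_le hG v₀ (Dispersion.slack_nonneg n) N
  set E₁ := {ω | ∃ t ≤ N, (ε / 16) ^ 2 ≤
    Dispersion.relDev n t (Dispersion.numUnhappy v₀ (fun i t => G i t ω) t) ^ 2} with hE₁
  set E₂ := {ω | ε / 16 ≤ ∑ t ∈ Finset.range (N + 1),
    |(Dispersion.numUnhappy v₀ (fun i t => G i t ω) t : ℝ) / n - Dispersion.fluid t|} with hE₂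
  set E₃ := {ω | ∃ t < N, 0 < Dispersion.numUnhappy v₀ (fun i t => G i t ω) t ∧
    Dispersion.slack n * √(Dispersion.numUnhappy v₀ (fun i t => G i t ω) t : ℝ) ≤
      |(Dispersion.numUnhappy v₀ (fun i t => G i t ω) (t + 1) : ℝ)
        - Dispersion.stepMean n (M n) (Dispersion.numUnhappy v₀ (fun i t => G i t ω) t)|} with hE₃
  have hb₁ : P.real E₁ ≤ C * δ ^ 2 / (ε / 16) ^ 2 := by
    refine hbad₁.trans ?_
    rw [mul_div_assoc C]
    gcongr
  have hb₂ : P.real E₂ ≤ C * (4 * δ ^ 2) / (ε / 16) ^ 2 := by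
    refine hbad₂.trans ?_
    rw [mul_div_assoc C]
    gcongr
    calc ((N : ℝ) + 1) ^ 2 / n ≤ (2 * N) ^ 2 / n := by
          gcongr
          linarith
      _ = 4 * ((N : ℝ) ^ 2 / n) := by ring
      _ ≤ _ := by gcongr
  have hb₃ : P.real E₃ ≤ δ / 2 := by
    refine hbad₃.trans (le_trans ?_ hexp)
    gcongr
  have hsplit : C * δ ^ 2 / (ε / 16) ^ 2 + C * (4 * δ ^ 2) / (ε / 16) ^ 2
      = 5 * C * δ ^ 2 / (ε / 16) ^ 2 := by ring
  -- Subadditivity suffices here, so no measurability of the events is needed.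
  have hcover : P.real (Set.univ : Set Ω) ≤ P.real (E₁ ∪ E₂ ∪ E₃)
      + P.real (E₁ ∪ E₂ ∪ E₃)ᶜ := by
    rw [← Set.union_compl_self (E₁ ∪ E₂ ∪ E₃)]
    exact measureReal_union_le _ _
  have hunion : P.real (E₁ ∪ E₂ ∪ E₃) ≤ P.real E₁ + P.real E₂ + P.real E₃ :=
    (measureReal_union_le _ _).trans (by gcongr; exact measureReal_union_le _ _)
  rw [probReal_univ] at hcover
  refine le_trans (b := P.real (E₁ ∪ E₂ ∪ E₃)ᶜ) (by linarith) (measureReal_mono ?_)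
  intro ω hω
  simp only [Set.mem_compl_iff, Set.mem_union, not_or] at hω
  obtain ⟨⟨h1, h2⟩, h3⟩ := hω
  simp only [hE₁, Set.mem_ofPred_eq, not_exists, not_and, not_le] at h1
  simp only [hE₂, Set.mem_ofPred_eq, not_le] at h2
  simp only [hE₃, Set.mem_ofPred_eq, not_exists, not_and, not_le] at h3
  obtain ⟨T, ⟨hT0, hTL, hTmin⟩, hTU, hTT, hTsum⟩ := Dispersion.exists_hit_of_close (c := c) hε hε4
    hδ hn hMn hM35 hA hearly hupn hlown hover
    (fun T hT => hT₁ T (by exact_mod_cast hlate.trans hT))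
    (Dispersion.numUnhappy v₀ fun i t => G i t ω) (Dispersion.numUnhappy_le v₀ _)
    (fun t ht => (abs_lt_of_sq_lt_sq (h1 t ht) hη.le).le) h2.le (fun t ht hu => (h3 t ht hu).le)
  exact ⟨T, Dispersion.hitTime_eq v₀ _ hT0 hTL hTmin, hTU,
    hTT.trans (mul_le_mul_of_nonneg_right hεε₀ (by positivity)),
    hTsum.trans (mul_le_mul_of_nonneg_right hεε₀ (by positivity))⟩
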